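/- Let $1\le N_T\le N_R$, $N=N_R-N_T+1$, $E_s,N_0>0$, $\Gamma_s=\frac{E_s}{N_0}\frac1{N_T}$ and $K\ge 0$. Consider the $N_R\times N_T$ random channel matrix $$H=H_d+H_r=\sqrt{\tfrac{K}{K+1}}\,H_{d,n}+\sqrt{\tfrac1{K+1}}\,H_{r,n},$$ where $H_{d,n}$ is deterministic with $\|H_{d,n}\|^2=N_TN_R$ (Frobenius norm) and the rows of $H_{r,n}$ are independent, each with conjugate transpose distributed as $\mathcal{CN}(0,R_T)$ (circularly symmetric complex Gaussian), $R_T$ being Hermitian positive definite with unit diagonal. Assume Rician–Rayleigh fading: all columns of $H_d$ except possibly the first vanish. Put $R_{T,K}=\frac1{K+1}R_T$, $\Gamma_1=\Gamma_s/[R_{T,K}^{-1}]_{1,1}$ and $a=[R_{T,K}^{-1}]_{1,1}\|\mu\|^2$, where $\mu=h_{d,1}-H_{d,2}R_{22}^{-1}R_{21}$; here $h_{d,1}$ is the first column of $H_d$, $H_{d,2}$ consists of the other columns, and $R_{22},R_{21}$ are the blocks of $R_{T,K}$ with row indices $2,\dots,N_T$ and column indices $2,\dots,N_T$, respectively $1$.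 (Thus $\mu=h_{d,1}$ here.) Let $$\gamma_1=\frac{\Gamma_s}{[(H^{\mathcal H}H)^{-1}]_{1,1}}$$ be the zero-forcing SNR of stream 1, $(x)_n=x(x+1)\cdots(x+n-1)$ with $(x)_0=1$, and $A_n(a)=\frac{(N)_n}{(N_R)_n}\frac{a^n}{n!}$. Then: 1. The mean, second moment, variance and amount of fading of $\gamma_1$ are $$\mathbb E\{\gamma_1\}=N\Gamma_1\Big(1+\frac a{N_R}\Big),\qquad \mathbb E\{\gamma_1^2\}=N(N+1)\Gamma_1^2\Big[\Big(1+\frac a{N_R}\Big)^2-\frac{a^2}{N_R^2}\frac1{N_R+1}\Big],$$ $$\mathbb V\{\gamma_1\}=N\Gamma_1^2\Big[\Big(1+\frac a{N_R}\Big)^2-\frac{a^2}{N_R^2}\frac{N+1}{N_R+1}\Big],\qquad \mathbb A\{\gamma_1\}=\frac{\mathbb V\{\gamma_1\}}{(\mathbb E\{\gamma_1\})^2}=\frac1N\Big[1-\frac{N+1}{N_R+1}\frac{a^2}{(a+N_R)^2}\Big].$$ 2. For Rayleigh–Rayleigh fading ($K=0$) these equal $N\Gamma_1$, $N(N+1)\Gamma_1^2$,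 $N\Gamma_1^2$ and $1/N$, respectively. 3. The moment generating function $M_{\gamma_1}(s)=\mathbb E\{e^{s\gamma_1}\}$ is analytic at $s=0$, and for every integer $p\ge 0$ the $p$-th moment of $\gamma_1$ is finite and $$\mathbb E\{\gamma_1^p\}=M_{\gamma_1}^{(p)}(0)=\Gamma_1^p\sum_{n=0}^\infty A_n(a)\sum_{m=0}^n\binom nm(-1)^m(N+n-m)_p,$$ with a convergent series. 4. One has $a=KN_RN_T[R_T^{-1}]_{1,1}$, and Rician fading yields an array gain (ratio of average SNRs) of $$1+\frac a{N_R}=1+KN_T[R_T^{-1}]_{1,1}$$ over Rayleigh fading with the same $\Gamma_1$. That is, $\mathbb E\{\gamma_1\}$ is this factor times the average ZF SNR of stream 1 for the channel $H_r$ (the mean $H_d$ removed, $\Gamma_s$ unchanged), and likewise times the average ZF SNR of stream 1 for any Rayleigh channel ($K=0$) of the same dimensions, with any admissible correlation matrix and any $E_s,N_0>0$, that has the same value of $\Gamma_1$. -/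

import Mathlib

open MeasureTheory ProbabilityTheory
open scoped ComplexOrder

noncomputable section

/-- `X ∼ 𝒞𝒩(m, C)`: the complex random vector `X` is (jointly) Gaussian, with mean `m`,
covariance `𝔼[(X - m)(X - m)ᴴ] = C`, and it is circularly symmetric about its mean, i.e. its
pseudo-covariance `𝔼[(X - m)(X - m)ᵀ]` vanishes. -/
structure HasComplexGaussianLaw {Ω ι : Type*} [MeasurableSpace Ω] [Fintype ι]
    (X : Ω → ι → ℂ) (m : ι → ℂ) (C : Matrix ι ι ℂ) (P : Measure Ω) : Prop where
  gaussian : HasGaussianLaw X P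
  mean : ∀ i, ∫ ω, X ω i ∂P = m i
  covariance : ∀ i j, ∫ ω, (X ω i - m i) * star (X ω j - m j) ∂P = C i j
  pseudoCovariance : ∀ i j, ∫ ω, (X ω i - m i) * (X ω j - m j) ∂P = 0

/-- The deterministic component `H_d = √(K/(K+1)) H_{d,n}` of the channel matrix. -/
def channelMean {nR nT : ℕ} (K : ℝ) (Hdn : Matrix (Fin nR) (Fin nT) ℂ) :
    Matrix (Fin nR) (Fin nT) ℂ :=
  ((Real.sqrt (K / (K + 1)) : ℝ) : ℂ) • Hdn

/-- The random component `H_r = √(1/(K+1)) H_{r,n}` of the channel matrix. -/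
def channelRandom {Ω : Type*} {nR nT : ℕ} (K : ℝ) (Hrn : Ω → Matrix (Fin nR) (Fin nT) ℂ)
    (ω : Ω) : Matrix (Fin nR) (Fin nT) ℂ :=
  ((Real.sqrt (1 / (K + 1)) : ℝ) : ℂ) • Hrn ω

/-- The channel matrix `H = H_d + H_r`. -/
def channelMatrix {Ω : Type*} {nR nT : ℕ} (K : ℝ) (Hdn : Matrix (Fin nR) (Fin nT) ℂ)
    (Hrn : Ω → Matrix (Fin nR) (Fin nT) ℂ) (ω : Ω) : Matrix (Fin nR) (Fin nT) ℂ :=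
  channelMean K Hdn + channelRandom K Hrn ω

/-- The fading model: Rician factor `K ≥ 0`; normalized mean `H_{d,n}` with
`‖H_{d,n}‖² = N_T N_R` (Frobenius norm); transmit-correlation matrix `R_T`, Hermitian positive
definite with unit diagonal; and zero receive-correlation, i.e. the rows of the normalized random
component `H_{r,n}` are independent and their conjugate transposes are `𝒞𝒩(0, R_T)`. -/
structure IsFadingModel {Ω : Type*} [MeasurableSpace Ω] {nR nT : ℕ} (K : ℝ)
    (Hdn : Matrix (Fin nR) (Fin nT) ℂ) (RT : Matrix (Fin nT) (Fin nT) ℂ)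
    (Hrn : Ω → Matrix (Fin nR) (Fin nT) ℂ) (P : Measure Ω) : Prop where
  K_nonneg : 0 ≤ K
  mean_normalized : ∑ i, ∑ j, ‖Hdn i j‖ ^ 2 = (nT : ℝ) * (nR : ℝ)
  correlation_posDef : RT.PosDef
  correlation_diag : ∀ j, RT j j = 1
  rows_indep : iIndepFun (fun (i : Fin nR) (ω : Ω) => Hrn ω i) P
  rows_law : ∀ i, HasComplexGaussianLaw (fun ω j => star (Hrn ω i j)) 0 RT P

/-- Rician–Rayleigh fading: all columns of `H_d` but the first one (the intended stream) vanish. -/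
def IsRicianRayleigh {nR nT : ℕ} [NeZero nT] (K : ℝ) (Hdn : Matrix (Fin nR) (Fin nT) ℂ) : Prop :=
  ∀ i, ∀ k : Fin nT, k ≠ 0 → channelMean K Hdn i k = 0

/-- Per-symbol input SNR `Γ_s = (E_s / N_0) (1 / N_T)`. -/
def inputSNR (nT : ℕ) (Es N0 : ℝ) : ℝ := Es / N0 * (1 / (nT : ℝ))

/-- The zero-forcing SNR of the first stream, `Γ_s / [W⁻¹]_{1,1}` with `W = Hᴴ H`
(the entry `[W⁻¹]_{1,1}` is real). -/
def zfSNR {nR nT : ℕ} [NeZero nT] (Γs : ℝ) (H : Matrix (Fin nR) (Fin nT) ℂ) : ℝ :=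
  Γs / (((H.conjTranspose * H)⁻¹) 0 0).re

/-- The transmit-covariance matrix `R_{T,K} = (1/(K+1)) R_T`. -/
def transmitCov {nT : ℕ} (K : ℝ) (RT : Matrix (Fin nT) (Fin nT) ℂ) :
    Matrix (Fin nT) (Fin nT) ℂ :=
  ((1 / (K + 1) : ℝ) : ℂ) • RT

/-- `Γ₁ = Γ_s / [R_{T,K}⁻¹]_{1,1}`. -/
def gammaScale {nT : ℕ} [NeZero nT] (Γs K : ℝ) (RT : Matrix (Fin nT) (Fin nT) ℂ) : ℝ :=
  Γs / (((transmitCov K RT)⁻¹) 0 0).re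

/-- `r_{2,1} = R_{22}⁻¹ R_{21}`, where `R_{22}` and `R_{21}` are the blocks of `R_{T,K}` of the
interfering streams with themselves and with the first stream. -/
def regressionVector {nT : ℕ} [NeZero nT] (K : ℝ) (RT : Matrix (Fin nT) (Fin nT) ℂ) :
    {k : Fin nT // k ≠ 0} → ℂ :=
  Matrix.mulVec
    ((transmitCov K RT).submatrix Subtype.val Subtype.val :
      Matrix {k : Fin nT // k ≠ 0} {k : Fin nT // k ≠ 0} ℂ)⁻¹
    (fun k => transmitCov K RT k.val 0)

/-- `μ = h_{d,1} - H_{d,2} r_{2,1}`, where `h_{d,1}` is the first column of `H_d` and `H_{d,2}`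
consists of its other columns. -/
def residualMean {nR nT : ℕ} [NeZero nT] (K : ℝ) (Hdn : Matrix (Fin nR) (Fin nT) ℂ)
    (RT : Matrix (Fin nT) (Fin nT) ℂ) : Fin nR → ℂ :=
  fun i => channelMean K Hdn i 0 -
    ∑ k : {k : Fin nT // k ≠ 0}, channelMean K Hdn i k.val * regressionVector K RT k

/-- `a = [R_{T,K}⁻¹]_{1,1} ‖μ‖²` (Euclidean norm). -/
def ricianParam {nR nT : ℕ} [NeZero nT] (K : ℝ) (Hdn : Matrix (Fin nR) (Fin nT) ℂ)
    (RT : Matrix (Fin nT) (Fin nT) ℂ) : ℝ :=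
  (((transmitCov K RT)⁻¹) 0 0).re * ∑ i, ‖residualMean K Hdn RT i‖ ^ 2

/-- Pochhammer symbol `(x)_n = x (x+1) ⋯ (x+n-1)`. -/
def poch (x : ℝ) (n : ℕ) : ℝ := (ascPochhammer ℝ n).eval x

/-- `A_n(σ) = (N)_n / (N_R)_n · σⁿ / n!`. -/
def seriesCoeff (N nR n : ℕ) (σ : ℝ) : ℝ :=
  poch N n / poch nR n * (σ ^ n / (n.factorial : ℝ))

/-- Amount of fading `𝔸{γ} = 𝕍{γ} / (𝔼{γ})²`. -/
def amountOfFading {Ω : Type*} [MeasurableSpace Ω] (γ : Ω → ℝ) (P : Measure Ω) : ℝ :=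
  variance γ P / (∫ ω, γ ω ∂P) ^ 2

/-- Array gain: the ratio of the average SNR to a reference average SNR. -/
def arrayGain {Ω Ω' : Type*} [MeasurableSpace Ω] [MeasurableSpace Ω']
    (γ : Ω → ℝ) (P : Measure Ω) (γref : Ω' → ℝ) (Q : Measure Ω') : ℝ :=
  (∫ ω, γ ω ∂P) / (∫ ω, γref ω ∂Q)

end

/-! ### Exponential moments of the squared norm of a Gaussian vector -/

/-! Whitening by a matrix `A` whose first row is supported on the first column turns the channel
into i.i.d. standard Gaussian columns `z, B 0, B 1, …` in `ℂᵈ` (`d = nR`), with a deterministic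
vector `w` added to the first column only. Then `γ₁ = Γ₁ * zfGain (w + z) B / 2` with `‖w‖² / 2 = a`
(`zfSNR_eq_zfGain`, `map_columnsMulL`).

The gain is the squared norm of the projection of `w + z` onto the orthogonal complement of the span
of `B`, of complex dimension `N` almost surely. Given `B`, this is a noncentral chi-square variable
with `2N` real degrees of freedom, so averaging over `B` gives the mgf `(1 - s)⁻ᴺ G (s / (1 - s))`,
where `G` is the mgf of `zfGain w B / 2` for fixed `w` (`integral_exp_zfGain_add`).

The moments of `zfGain w B` need no density (`integral_zfGain_pow`). By unitary invariance and
homogeneity the `p`-th one is `c ‖w‖²ᵖ`. Replacing `w` by an independent Gaussian vector and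
integrating in both orders gives `c (d)_p = (N)_p`. Hence the Taylor coefficients of `G` are the
`A_n(a)`.

Finally, `sⁿ (1 - s)⁻⁽ᴺ⁺ⁿ⁾` has the inner alternating sum as `p`-th derivative at 0, and this
vanishes for `n > p`. So the moment series is a finite sum, and `p = 1, 2` give the closed forms. -/

lemma gaussianPDFReal_mul_exp_sq {s : ℝ} (hs : s < 1) (w x : ℝ) :
    gaussianPDFReal 0 1 x * Real.exp (s / 2 * (w + x) ^ 2) =
      ((√(1 - s))⁻¹ * Real.exp (s / (2 * (1 - s)) * w ^ 2)) *
        gaussianPDFReal (s * w / (1 - s)) (1 / (1 - s)).toNNReal x := by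
  have h : 0 < 1 - s := by linarith
  have h' : 1 - s ≠ 0 := h.ne'
  simp only [gaussianPDFReal, NNReal.coe_one, mul_one, sub_zero]
  rw [Real.coe_toNNReal _ (by positivity)]
  have e1 : √(2 * Real.pi * (1 / (1 - s))) = √(2 * Real.pi) * (√(1 - s))⁻¹ := by
    rw [Real.sqrt_mul (by positivity), one_div, Real.sqrt_inv]
  have hq : √(1 - s) ≠ 0 := (Real.sqrt_pos.2 h).ne'
  -- Completing the square in `x`: the tilted density is a multiple of a Gaussian density of
  -- variance `1 / (1 - s)`.
  have e2 : Real.exp (-x ^ 2 / 2) * Real.exp (s / 2 * (w + x) ^ 2) =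
      Real.exp (s / (2 * (1 - s)) * w ^ 2) *
        Real.exp (-(x - s * w / (1 - s)) ^ 2 / (2 * (1 / (1 - s)))) := by
    rw [← Real.exp_add, ← Real.exp_add]
    congr 1
    field_simp
    ring
  rw [e1, mul_assoc, e2]
  field_simp

lemma integrable_exp_sq_gaussianReal {s : ℝ} (hs : s < 1) (w : ℝ) :
    Integrable (fun x => Real.exp (s / 2 * (w + x) ^ 2)) (gaussianReal 0 1) := by
  rw [gaussianReal_of_var_ne_zero _ one_ne_zero,
    integrable_withDensity_iff_integrable_smul₀' (by fun_prop)
      (ae_of_all _ fun _ => gaussianPDF_lt_top)]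
  simp only [toReal_gaussianPDF, smul_eq_mul, gaussianPDFReal_mul_exp_sq hs]
  exact (integrable_gaussianPDFReal _ _).const_mul _

lemma integral_exp_sq_gaussianReal {s : ℝ} (hs : s < 1) (w : ℝ) :
    ∫ x, Real.exp (s / 2 * (w + x) ^ 2) ∂(gaussianReal 0 1) =
      (√(1 - s))⁻¹ * Real.exp (s / (2 * (1 - s)) * w ^ 2) := by
  have h : 0 < 1 - s := by linarith
  rw [integral_gaussianReal_eq_integral_smul one_ne_zero]
  simp only [smul_eq_mul, gaussianPDFReal_mul_exp_sq hs]
  rw [integral_const_mul, integral_gaussianPDFReal_eq_one, mul_one]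
  simpa using h

section Real

variable {F : Type*} [NormedAddCommGroup F] [InnerProductSpace ℝ F] [FiniteDimensional ℝ F]
  [MeasurableSpace F] [BorelSpace F]

omit [FiniteDimensional ℝ F] [MeasurableSpace F] [BorelSpace F] in
lemma exp_norm_add_sum_smul_sq {ι : Type*} [Fintype ι] (b : OrthonormalBasis ι ℝ F) (s : ℝ)
    (w : F) (x : ι → ℝ) :
    Real.exp (s / 2 * ‖w + ∑ i, x i • b i‖ ^ 2) =
      ∏ i, Real.exp (s / 2 * (inner ℝ (b i) w + x i) ^ 2) := by
  classical
  rw [← Real.exp_sum, ← Finset.mul_sum, ← b.sum_sq_inner_right]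
  congr 2
  refine Finset.sum_congr rfl fun i _ => ?_
  rw [inner_add_right, b.orthonormal.inner_right_fintype]

lemma integrable_exp_norm_sq_stdGaussian {s : ℝ} (hs : s < 1) (w : F) :
    Integrable (fun z => Real.exp (s / 2 * ‖w + z‖ ^ 2)) (stdGaussian F) := by
  rw [stdGaussian, integrable_map_measure (by fun_prop) (Measurable.aemeasurable (by fun_prop))]
  simp only [Function.comp_def, exp_norm_add_sum_smul_sq]
  exact Integrable.fintype_prod fun i => integrable_exp_sq_gaussianReal hs _

/-- The noncentral chi-square mgf. By Parseval the integrand factors over the independent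
coordinates. -/
lemma integral_exp_norm_sq_stdGaussian {s : ℝ} (hs : s < 1) (w : F) :
    ∫ z, Real.exp (s / 2 * ‖w + z‖ ^ 2) ∂(stdGaussian F) =
      (√(1 - s))⁻¹ ^ Module.finrank ℝ F * Real.exp (s / (2 * (1 - s)) * ‖w‖ ^ 2) := by
  rw [stdGaussian, integral_map (Measurable.aemeasurable (by fun_prop)) (by fun_prop)]
  simp only [exp_norm_add_sum_smul_sq]
  rw [integral_fintype_prod_eq_prod
    (f := fun i x => Real.exp (s / 2 * (inner ℝ (stdOrthonormalBasis ℝ F i) w + x) ^ 2))]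
  simp only [integral_exp_sq_gaussianReal hs]
  rw [Finset.prod_mul_distrib, ← Real.exp_sum, ← Finset.mul_sum,
    (stdOrthonormalBasis ℝ F).sum_sq_inner_right]
  simp

/-- The image of the standard Gaussian measure under a coisometry is standard Gaussian. -/
lemma stdGaussian_map_of_inner_eq {F' : Type*} [NormedAddCommGroup F'] [InnerProductSpace ℝ F']
    [FiniteDimensional ℝ F'] [MeasurableSpace F'] [BorelSpace F'] (L : F →L[ℝ] F') (J : F' → F)
    (hJ : ∀ t, ‖J t‖ = ‖t‖) (hL : ∀ z t, inner ℝ (L z) t = inner ℝ z (J t)) :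
    (stdGaussian F).map L = stdGaussian F' := by
  have : IsProbabilityMeasure ((stdGaussian F).map L) :=
    Measure.isProbabilityMeasure_map (by fun_prop)
  apply Measure.ext_of_charFun
  ext t
  -- The characteristic function depends on the norm alone, and `J`, the adjoint of `L`, preserves
  -- norms.
  rw [charFun_stdGaussian, ← hJ, ← charFun_stdGaussian, charFun_apply, charFun_apply,
    integral_map (by fun_prop) (by fun_prop)]
  simp only [hL]

/-- A proper affine hyperplane is null for the standard Gaussian measure. -/
lemma ae_inner_ne_stdGaussian {t : F} (ht : t ≠ 0) (c : ℝ) :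
    ∀ᵐ z ∂(stdGaussian F), inner ℝ t z ≠ c := by
  have h1 : (stdGaussian F).map (innerSL ℝ t) = gaussianReal 0 (‖t‖ ^ 2).toNNReal := by
    rw [IsGaussian.map_eq_gaussianReal, integral_strongDual_stdGaussian,
      variance_dual_stdGaussian, innerSL_apply_norm]
  have := nullSingletonClass_gaussianReal (μ := 0) (v := (‖t‖ ^ 2).toNNReal) (by simpa using ht)
  have h2 : ∀ᵐ x ∂((stdGaussian F).map (innerSL ℝ t)), x ≠ c := by
    rw [h1, ae_iff]
    simp
  simpa using ae_of_ae_map (by fun_prop) h2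

end Real

/-! ### The zero-forcing gain -/

/-- The inverse of the first diagonal entry of the inverse Gram matrix of `h, B 0, B 1, …`. -/
noncomputable def zfGain {E : Type*} [NormedAddCommGroup E] [InnerProductSpace ℂ E] {n : ℕ}
    (h : E) (B : Fin n → E) : ℝ :=
  (((Matrix.gram ℂ (Fin.cons h B : Fin (n + 1) → E))⁻¹ 0 0).re)⁻¹

section Gain

variable {E : Type*} [NormedAddCommGroup E] [InnerProductSpace ℂ E] {n : ℕ}

/-- The gain is a function of the Gram matrix, which isometries preserve. -/
lemma zfGain_map (U : E ≃ₗᵢ[ℂ] E) (h : E) (B : Fin n → E) :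
    zfGain (U h) (fun j => U (B j)) = zfGain h B := by
  have : Matrix.gram ℂ (Fin.cons (U h) (fun j => U (B j)) : Fin (n + 1) → E) =
      Matrix.gram ℂ (Fin.cons h B : Fin (n + 1) → E) := by
    have hc : (Fin.cons (U h) (fun j => U (B j)) : Fin (n + 1) → E) =
        fun j => U ((Fin.cons h B : Fin (n + 1) → E) j) := by
      ext j; refine Fin.cases ?_ (fun k => ?_) j <;> simp
    ext i j
    simp only [Matrix.gram_apply, hc, LinearIsometryEquiv.inner_map_map]
  rw [zfGain, this, zfGain]

lemma measurable_zfGain [FiniteDimensional ℂ E] [MeasurableSpace E] [BorelSpace E] :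
    Measurable fun p : E × (Fin n → E) => zfGain p.1 p.2 := by
  have hg : ∀ i j, Continuous fun p : E × (Fin n → E) =>
      Matrix.gram ℂ (Fin.cons p.1 p.2 : Fin (n + 1) → E) i j := by
    have hc : ∀ i, Continuous fun p : E × (Fin n → E) =>
        (Fin.cons p.1 p.2 : Fin (n + 1) → E) i := by
      intro i
      refine Fin.cases ?_ (fun k => ?_) i
      · simpa using continuous_fst
      · simpa [Function.comp_def] using
          (continuous_apply (A := fun _ : Fin n => E) k).comp (continuous_snd (X := E))
    intro i j
    simp only [Matrix.gram_apply]
    exact (hc i).inner (hc j)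
  have hG : Continuous fun p : E × (Fin n → E) =>
      Matrix.gram ℂ (Fin.cons p.1 p.2 : Fin (n + 1) → E) := by
    exact continuous_matrix hg
  have : FiniteDimensional ℝ E := FiniteDimensional.complexToReal E
  unfold zfGain
  -- Adjugate over determinant: both are continuous, and the totalized inverse is measurable.
  simp only [Matrix.inv_def, Ring.inverse_eq_inv', Matrix.smul_apply, smul_eq_mul]
  have h1 : Measurable fun p : E × (Fin n → E) =>
      (Matrix.gram ℂ (Fin.cons p.1 p.2 : Fin (n + 1) → E)).det := hG.matrix_det.measurable
  have h2 : Measurable fun p : E × (Fin n → E) =>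
      (Matrix.gram ℂ (Fin.cons p.1 p.2 : Fin (n + 1) → E)).adjugate 0 0 :=
    (hG.matrix_adjugate.matrix_elem 0 0).measurable
  exact (Complex.measurable_re.comp (h1.inv.mul h2)).inv

variable [FiniteDimensional ℂ E]

/-- The zero-forcing gain is the squared norm of the component of the intended column that is
orthogonal to the interfering columns. -/
lemma zfGain_eq_norm_sq {B : Fin n → E} (hB : LinearIndependent ℂ B) (h : E) :
    zfGain h B = ‖(Submodule.span ℂ (Set.range B))ᗮ.starProjection h‖ ^ 2 := by
  classical
  set V := Submodule.span ℂ (Set.range B)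
  set v : Fin (n + 1) → E := Fin.cons h B
  set W := Matrix.gram ℂ v
  by_cases hv : LinearIndependent ℂ v
  · have hdet : IsUnit W.det :=
      isUnit_iff_ne_zero.2 (Matrix.det_gram_ne_zero_iff_linearIndependent.2 hv)
    -- The first column of `W⁻¹` gives the vector `u` dual to `h`: it is orthogonal to `V` and has
    -- inner product 1 with `h`. Hence `u = y 0 • Ph`, with `P` the projection onto `Vᗮ`, and `y 0 =
    -- ‖u‖²`, which forces `‖Ph‖ = ‖u‖⁻¹`.
    set y : Fin (n + 1) → ℂ := fun k => W⁻¹ k 0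
    set u : E := ∑ k, y k • v k
    have hu : ∀ i, inner ℂ (v i) u = if i = 0 then 1 else 0 := by
      intro i
      have : (W * W⁻¹) i 0 = (1 : Matrix (Fin (n + 1)) (Fin (n + 1)) ℂ) i 0 := by rw [Matrix.mul_nonsing_inv _ hdet]
      rw [Matrix.mul_apply, Matrix.one_apply] at this
      rw [← this, inner_sum]
      refine Finset.sum_congr rfl fun k _ => ?_
      rw [inner_smul_right]
      exact mul_comm _ _
    have huV : u ∈ Vᗮ := by
      rw [Submodule.mem_orthogonal]
      intro x hx
      induction hx using Submodule.span_induction with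
      | mem x hx =>
        obtain ⟨k, rfl⟩ := hx
        simpa [v] using hu k.succ
      | zero => simp
      | add x y _ _ h1 h2 => rw [inner_add_left, h1, h2, add_zero]
      | smul c x _ h1 => rw [inner_smul_left, h1, mul_zero]
    have hproj : u = y 0 • Vᗮ.starProjection h := by
      have h1 : u = ∑ k, y k • Vᗮ.starProjection (v k) := by
        rw [← Submodule.starProjection_eq_self_iff.2 huV]
        simp only [u, map_sum, map_smul]
      rw [h1, Fin.sum_univ_succ, Finset.sum_eq_zero, add_zero]
      · simp [v]
      · intro k _
        have : Vᗮ.starProjection (v k.succ) = 0 := by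
          rw [Submodule.starProjection_apply_eq_zero_iff, Submodule.orthogonal_orthogonal]
          exact Submodule.subset_span ⟨k, by simp [v]⟩
        rw [this, smul_zero]
    have hnorm : inner ℂ u u = star (y 0) := by
      have h1 : inner ℂ (∑ k, y k • v k) u = star (y 0) := by
        rw [sum_inner]
        simp only [inner_smul_left, hu]
        simp
      exact h1
    have hreal : y 0 = ((‖u‖ ^ 2 : ℝ) : ℂ) := by
      have h1 := inner_self_eq_norm_sq_to_K (𝕜 := ℂ) u
      rw [hnorm] at h1
      have := congrArg star h1
      rw [star_star] at this
      rw [this]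
      simp
    have h0 : ‖u‖ ^ 2 ≠ 0 := by
      intro h0
      have hu0 : u = 0 := by simpa using h0
      have := hu 0
      simp [hu0] at this
    have hn : ‖u‖ = ‖u‖ ^ 2 * ‖Vᗮ.starProjection h‖ := by
      conv_lhs => rw [hproj, norm_smul, hreal]
      simp
    change ((y 0).re)⁻¹ = _
    rw [hreal, Complex.ofReal_re]
    have h0' : ‖u‖ ≠ 0 := fun h => h0 (by simp [h])
    have : ‖Vᗮ.starProjection h‖ = ‖u‖⁻¹ := by
      field_simp
      field_simp at hn
      linarith
    rw [this]; simp
  -- In the degenerate case `h ∈ V`, the conventions `W⁻¹ = 0` and `0⁻¹ = 0` make the gain 0, which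
  -- agrees with the projection.
  · have hdet : W.det = 0 := by
      by_contra hne
      exact hv (Matrix.det_gram_ne_zero_iff_linearIndependent.1 hne)
    have hh : h ∈ V := by
      by_contra hne
      exact hv (linearIndependent_finCons.2 ⟨hB, hne⟩)
    have h1 : zfGain h B = 0 := by
      change ((W⁻¹ 0 0).re)⁻¹ = 0
      rw [Matrix.nonsing_inv_apply_not_isUnit _ (by simp [hdet])]
      simp
    rw [h1, (Submodule.starProjection_apply_eq_zero_iff _).2]
    · simp
    · rwa [Submodule.orthogonal_orthogonal]

lemma zfGain_nonneg {B : Fin n → E} (hB : LinearIndependent ℂ B) (h : E) : 0 ≤ zfGain h B := by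
  rw [zfGain_eq_norm_sq hB]; positivity

lemma zfGain_le {B : Fin n → E} (hB : LinearIndependent ℂ B) (h : E) :
    zfGain h B ≤ ‖h‖ ^ 2 := by
  rw [zfGain_eq_norm_sq hB]
  gcongr
  exact Submodule.norm_starProjection_apply_le _ _

lemma zfGain_smul {B : Fin n → E} (hB : LinearIndependent ℂ B) (c : ℂ) (h : E) :
    zfGain (c • h) B = ‖c‖ ^ 2 * zfGain h B := by
  rw [zfGain_eq_norm_sq hB, zfGain_eq_norm_sq hB, map_smul, norm_smul, mul_pow]

lemma zfGain_of_isEmpty (h : E) (B : Fin 0 → E) : zfGain h B = ‖h‖ ^ 2 := by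
  rw [zfGain_eq_norm_sq linearIndependent_empty_type, Submodule.starProjection_eq_self_iff.2]
  simp

/-- A coordinate description of the zero-forcing gain. -/
lemma exists_orthonormal_zfGain_eq {B : Fin n → E} (hB : LinearIndependent ℂ B) {N : ℕ}
    (hN : N + n = Module.finrank ℂ E) :
    ∃ v : Fin N → E, Orthonormal ℂ v ∧ ∀ h, zfGain h B = ∑ k, ‖inner ℂ (v k) h‖ ^ 2 := by
  set V := Submodule.span ℂ (Set.range B)
  have hV : Module.finrank ℂ V = n := by
    simpa using finrank_span_eq_card hB
  have hV' : Module.finrank ℂ Vᗮ = N := by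
    have := Submodule.finrank_add_finrank_orthogonal V
    omega
  let b := (stdOrthonormalBasis ℂ Vᗮ).reindex (finCongr hV')
  refine ⟨fun k => (b k : E), b.orthonormal.comp_linearIsometry Vᗮ.subtypeₗᵢ, fun h => ?_⟩
  rw [zfGain_eq_norm_sq hB, Submodule.starProjection_apply, Submodule.norm_coe,
    ← b.sum_sq_norm_inner_right]
  refine Finset.sum_congr rfl fun k _ => ?_
  rw [Submodule.inner_orthogonalProjectionOnto_eq_of_mem_left]

end Gain

/-! ### Gaussian vectors in `ℂᵈ` -/

section ComplexGaussian

variable {d n : ℕ}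

lemma real_inner_eq_re_inner_euclidean {ι : Type*} [Fintype ι] (x y : EuclideanSpace ℂ ι) :
    inner ℝ x y = (inner ℂ x y).re := by
  simp only [PiLp.inner_apply, Complex.re_sum]
  exact Finset.sum_congr rfl fun i _ => real_inner_eq_re_inner ℂ _ _

lemma finrank_real_euclideanSpace_complex (N : ℕ) :
    Module.finrank ℝ (EuclideanSpace ℂ (Fin N)) = 2 * N := by
  rw [finrank_real_of_complex, finrank_euclideanSpace_fin]

/-- A proper subspace lies in the real hyperplane orthogonal to some nonzero `t ∈ Vᗮ`. -/
lemma stdGaussian_notMem_submodule {V : Submodule ℂ (EuclideanSpace ℂ (Fin d))} (hV : V ≠ ⊤) :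
    ∀ᵐ z ∂(stdGaussian (EuclideanSpace ℂ (Fin d))), z ∉ V := by
  have hV' : Vᗮ ≠ ⊥ := fun h => hV (Submodule.orthogonal_eq_bot_iff.1 h)
  obtain ⟨t, htV, ht⟩ := Submodule.exists_mem_ne_zero_of_ne_bot hV'
  filter_upwards [ae_inner_ne_stdGaussian ht 0] with z hz hzV
  apply hz
  rw [real_inner_eq_re_inner_euclidean, Submodule.inner_left_of_mem_orthogonal hzV htV]
  simp

/-- At most `d` independent standard Gaussian vectors in `ℂᵈ` are almost surely linearly
independent. -/
lemma ae_linearIndependent_stdGaussian (hn : n ≤ d) :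
    ∀ᵐ B ∂(Measure.pi fun _ : Fin n => stdGaussian (EuclideanSpace ℂ (Fin d))),
      LinearIndependent ℂ B := by
  induction n with
  | zero => exact ae_of_all _ fun B => linearIndependent_empty_type
  | succ n ih =>
    have hmp := (measurePreserving_piFinSuccAbove
      (fun _ : Fin (n + 1) => stdGaussian (EuclideanSpace ℂ (Fin d))) 0)
    have hmeas : MeasurableSet {p : EuclideanSpace ℂ (Fin d) × (Fin n → EuclideanSpace ℂ (Fin d)) |
        LinearIndependent ℂ (Fin.cons p.1 p.2 : Fin (n + 1) → EuclideanSpace ℂ (Fin d))} := by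
      have hc : Continuous fun p : EuclideanSpace ℂ (Fin d) × (Fin n → EuclideanSpace ℂ (Fin d)) =>
          (Fin.cons p.1 p.2 : Fin (n + 1) → EuclideanSpace ℂ (Fin d)) := by
        refine continuous_pi fun i => Fin.cases ?_ (fun k => ?_) i
        · simpa using continuous_fst
        · simpa [Function.comp_def] using
            (continuous_apply (A := fun _ : Fin n => EuclideanSpace ℂ (Fin d)) k).comp
              (continuous_snd (X := EuclideanSpace ℂ (Fin d)))
      exact (isOpen_setOfPred_linearIndependent.preimage hc).measurableSet
    have hprod : ∀ᵐ p ∂((stdGaussian (EuclideanSpace ℂ (Fin d))).prod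
        (Measure.pi fun _ : Fin n => stdGaussian (EuclideanSpace ℂ (Fin d)))),
        LinearIndependent ℂ (Fin.cons p.1 p.2 : Fin (n + 1) → EuclideanSpace ℂ (Fin d)) := by
      -- With the `n` independent vectors fixed, the new one only has to avoid their span, which is
      -- proper since `n < d`.
      rw [Measure.ae_prod_iff_ae_ae hmeas, Measure.ae_ae_comm hmeas]
      filter_upwards [ih (by omega)] with B hB
      have hV : Submodule.span ℂ (Set.range B) ≠ ⊤ := by
        intro h
        have h1 := finrank_span_eq_card hB
        rw [h, finrank_top, finrank_euclideanSpace_fin, Fintype.card_fin] at h1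
        omega
      filter_upwards [stdGaussian_notMem_submodule hV] with z hz
      exact linearIndependent_finCons.2 ⟨hB, hz⟩
    filter_upwards [hmp.quasiMeasurePreserving.ae hprod] with B hB
    simpa [MeasurableEquiv.piFinSuccAbove, Fin.insertNthEquiv] using hB

/-- The coordinates of a vector along an orthonormal family. -/
noncomputable def innerCoordsL {N : ℕ} (v : Fin N → EuclideanSpace ℂ (Fin d)) :
    EuclideanSpace ℂ (Fin d) →L[ℝ] EuclideanSpace ℂ (Fin N) :=
  (((PiLp.continuousLinearEquiv 2 ℂ (fun _ : Fin N => ℂ)).symm.toContinuousLinearMap ∘L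
    ContinuousLinearMap.pi fun k => innerSL ℂ (v k))).restrictScalars ℝ

lemma innerCoordsL_apply {N : ℕ} (v : Fin N → EuclideanSpace ℂ (Fin d))
    (z : EuclideanSpace ℂ (Fin d)) (k : Fin N) : innerCoordsL v z k = inner ℂ (v k) z := rfl

lemma stdGaussian_map_innerCoordsL {N : ℕ} {v : Fin N → EuclideanSpace ℂ (Fin d)}
    (hv : Orthonormal ℂ v) :
    (stdGaussian (EuclideanSpace ℂ (Fin d))).map (innerCoordsL v) =
      stdGaussian (EuclideanSpace ℂ (Fin N)) := by
  -- The adjoint of the coordinate map is synthesis along `v`, isometric by orthonormality.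
  refine stdGaussian_map_of_inner_eq _ (fun t => ∑ k, t k • v k) (fun t => ?_) fun z t => ?_
  · rw [← sq_eq_sq₀ (norm_nonneg _) (norm_nonneg _), EuclideanSpace.norm_sq_eq t]
    have := hv.inner_sum t t Finset.univ
    rw [inner_self_eq_norm_sq_to_K] at this
    have h2 := congrArg Complex.re this
    simp only [Complex.coe_algebraMap, Complex.re_sum] at h2
    have h3 : ∀ k, ((starRingEnd ℂ) (t k) * t k).re = ‖t k‖ ^ 2 := fun k => by
      rw [← Complex.normSq_eq_conj_mul_self, Complex.ofReal_re, Complex.normSq_eq_norm_sq]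
    simp only [h3] at h2
    rw [← h2]
    norm_cast
  · rw [real_inner_eq_re_inner_euclidean, real_inner_eq_re_inner_euclidean, inner_sum]
    rw [PiLp.inner_apply]
    simp only [innerCoordsL_apply, inner_smul_right, RCLike.inner_apply]
    congr 1
    refine Finset.sum_congr rfl fun k _ => ?_
    rw [inner_conj_symm]

lemma norm_innerCoordsL_sq {N : ℕ} (v : Fin N → EuclideanSpace ℂ (Fin d))
    (z : EuclideanSpace ℂ (Fin d)) :
    ‖innerCoordsL v z‖ ^ 2 = ∑ k, ‖inner ℂ (v k) z‖ ^ 2 := by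
  rw [EuclideanSpace.norm_sq_eq]; rfl

variable {N : ℕ} {B : Fin n → EuclideanSpace ℂ (Fin d)} {s : ℝ}

lemma integrable_exp_zfGain_stdGaussian (hB : LinearIndependent ℂ B) (hN : N + n = d)
    (hs : s < 1) (w : EuclideanSpace ℂ (Fin d)) :
    Integrable (fun z => Real.exp (s / 2 * zfGain (w + z) B))
      (stdGaussian (EuclideanSpace ℂ (Fin d))) := by
  obtain ⟨v, hv, hz⟩ := exists_orthonormal_zfGain_eq hB (N := N) (by simpa using hN)
  simp only [hz, ← norm_innerCoordsL_sq, map_add]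
  have := integrable_exp_norm_sq_stdGaussian hs (innerCoordsL v w)
  rw [← stdGaussian_map_innerCoordsL hv, integrable_map_measure (by fun_prop) (by fun_prop)] at this
  exact this

/-- The moment generating function of the zero-forcing gain, given the interfering columns. -/
lemma integral_exp_zfGain_stdGaussian (hB : LinearIndependent ℂ B) (hN : N + n = d)
    (hs : s < 1) (w : EuclideanSpace ℂ (Fin d)) :
    ∫ z, Real.exp (s / 2 * zfGain (w + z) B) ∂(stdGaussian (EuclideanSpace ℂ (Fin d))) =
      ((1 - s) ^ N)⁻¹ * Real.exp (s / (2 * (1 - s)) * zfGain w B) := by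
  obtain ⟨v, hv, hz⟩ := exists_orthonormal_zfGain_eq hB (N := N) (by simpa using hN)
  simp only [hz, ← norm_innerCoordsL_sq, map_add]
  have := integral_exp_norm_sq_stdGaussian hs (innerCoordsL v w)
  rw [← stdGaussian_map_innerCoordsL hv, integral_map (by fun_prop) (by fun_prop)] at this
  -- The real dimension `2N` turns the square roots into an `N`-th power.
  rw [this, finrank_real_euclideanSpace_complex, pow_mul, inv_pow, Real.sq_sqrt (by linarith),
    inv_pow]

end ComplexGaussian

/-! ### Derivatives at zero of `(1 - s)⁻ᴺ G (s / (1 - s))` -/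

lemma poch_succ (x : ℝ) (p : ℕ) : poch x (p + 1) = poch x p * (x + p) :=
  ascPochhammer_succ_eval p x

lemma poch_zero (x : ℝ) : poch x 0 = 1 := by simp [poch]

lemma poch_one (x : ℝ) : poch x 1 = x := by simp [poch]

lemma poch_two (x : ℝ) : poch x 2 = x * (x + 1) := by simp [poch_succ, poch_zero]

lemma poch_pos {x : ℝ} (hx : 0 < x) (p : ℕ) : 0 < poch x p := ascPochhammer_pos p x hx

/-- Stated for all `s < 1`, since the induction differentiates the formula on a neighbourhood. -/
lemma iteratedDeriv_inv_one_sub_pow (N p : ℕ) {s : ℝ} (hs : s < 1) :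
    iteratedDeriv p (fun s : ℝ => ((1 - s) ^ N)⁻¹) s = poch N p * ((1 - s) ^ (N + p))⁻¹ := by
  induction p generalizing s with
  | zero => simp [poch_zero]
  | succ p ih =>
    have h1 : iteratedDeriv p (fun s : ℝ => ((1 - s) ^ N)⁻¹) =ᶠ[nhds s]
        fun s => poch N p * ((1 - s) ^ (N + p))⁻¹ := by
      filter_upwards [Iio_mem_nhds hs] with t ht using ih ht
    have h0 : 1 - s ≠ 0 := by linarith
    have h2 : HasDerivAt (fun s : ℝ => poch N p * ((1 - s) ^ (N + p))⁻¹)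
        (poch N p * (((N + p : ℕ) : ℝ) * ((1 - s) ^ (N + p + 1))⁻¹)) s := by
      have h3 : HasDerivAt (fun s : ℝ => 1 - s) (-1) s := by
        simpa using (hasDerivAt_id s).const_sub 1
      convert! ((h3.pow (N + p)).inv (pow_ne_zero _ h0)).const_mul (poch N p) using 1
      -- The power rule produces the truncated exponent `N + p - 1`.
      rcases Nat.eq_zero_or_pos (N + p) with h | h
      · simp [h]
      · obtain ⟨k, hk⟩ : ∃ k, N + p = k + 1 := ⟨N + p - 1, by omega⟩
        rw [hk]
        simp only [Nat.add_sub_cancel, Pi.pow_apply]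
        field_simp
        ring
    rw [iteratedDeriv_succ, h1.deriv_eq, h2.deriv, poch_succ]
    push_cast
    ring_nf

lemma iteratedDeriv_pow_mul_eq_zero {f : ℝ → ℝ} (hf : AnalyticAt ℝ f 0) {n p : ℕ} (h : p < n) :
    iteratedDeriv p (fun s => s ^ n * f s) 0 = 0 := by
  have ha : AnalyticAt ℝ (fun s => s ^ n * f s) 0 := by fun_prop
  have : (n : ℕ∞) ≤ analyticOrderAt (fun s => s ^ n * f s) 0 :=
    (natCast_le_analyticOrderAt ha).2 ⟨f, hf, by simp⟩
  exact (natCast_le_analyticOrderAt_iff_iteratedDeriv_eq_zero ha).1 this p h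

lemma analyticAt_inv_one_sub_pow (N : ℕ) : AnalyticAt ℝ (fun s : ℝ => ((1 - s) ^ N)⁻¹) 0 := by
  apply AnalyticAt.fun_inv
  · fun_prop
  · simp

/-- The inner sum of the moment series, as a Taylor coefficient. -/
lemma iteratedDeriv_pow_mul_inv_one_sub_pow (N n p : ℕ) :
    iteratedDeriv p (fun s : ℝ => s ^ n * ((1 - s) ^ (N + n))⁻¹) 0 =
      ∑ m ∈ Finset.range (n + 1),
        (n.choose m : ℝ) * (-1) ^ m * poch ((N + n - m : ℕ) : ℝ) p := by
  have h1 : (fun s : ℝ => s ^ n * ((1 - s) ^ (N + n))⁻¹) =ᶠ[nhds 0] fun s =>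
      ∑ m ∈ Finset.range (n + 1), ((n.choose m : ℝ) * (-1) ^ m) * ((1 - s) ^ (N + n - m))⁻¹ := by
    filter_upwards [Iio_mem_nhds (show (0 : ℝ) < 1 by norm_num)] with s hs
    have h0 : 1 - s ≠ 0 := by have := Set.mem_Iio.1 hs; linarith
    -- The binomial theorem applied to this identity yields the alternating sum.
    have h2 : s * (1 - s)⁻¹ = -1 + (1 - s)⁻¹ := by field_simp; ring
    rw [pow_add, mul_inv, ← inv_pow, ← inv_pow, mul_left_comm, ← mul_pow, h2, add_pow,
      Finset.mul_sum]
    refine Finset.sum_congr rfl fun m hm => ?_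
    have hm' : m ≤ n := by simpa [Nat.lt_succ_iff] using hm
    rw [Nat.add_sub_assoc hm', pow_add, mul_inv, inv_pow, inv_pow]
    ring
  rw [h1.iteratedDeriv_eq, iteratedDeriv_fun_sum]
  · refine Finset.sum_congr rfl fun m _ => ?_
    rw [iteratedDeriv_const_mul_field, iteratedDeriv_inv_one_sub_pow _ _ one_pos]
    simp
  · intro m _
    exact (analyticAt_const.mul (analyticAt_inv_one_sub_pow _)).contDiffAt

/-- The sum is the `p`-th derivative at 0 of a function vanishing there to order at least `n`. This
truncates the moment series. -/
lemma sum_choose_poch_eq_zero (N : ℕ) {n p : ℕ} (h : p < n) :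
    ∑ m ∈ Finset.range (n + 1),
      (n.choose m : ℝ) * (-1) ^ m * poch ((N + n - m : ℕ) : ℝ) p = 0 := by
  rw [← iteratedDeriv_pow_mul_inv_one_sub_pow]
  exact iteratedDeriv_pow_mul_eq_zero (analyticAt_inv_one_sub_pow _) h

/-- Taylor expansion of `G` to order `p` suffices: after substitution the remainder still carries
the factor `s ^ (p + 1)`, so it does not affect the `p`-th derivative. -/
lemma iteratedDeriv_comp_div_one_sub {F G : ℝ → ℝ} {N : ℕ} (hG : AnalyticAt ℝ G 0)
    (hF : F =ᶠ[nhds 0] fun s => ((1 - s) ^ N)⁻¹ * G (s / (1 - s))) (p : ℕ) :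
    iteratedDeriv p F 0 = ∑ n ∈ Finset.range (p + 1), iteratedDeriv n G 0 / n.factorial *
      ∑ m ∈ Finset.range (n + 1),
        (n.choose m : ℝ) * (-1) ^ m * poch ((N + n - m : ℕ) : ℝ) p := by
  obtain ⟨R, hR, hGR⟩ := hG.exists_eventuallyEq_sum_add_pow_mul (p + 1)
  have hd : AnalyticAt ℝ (fun s : ℝ => s / (1 - s)) 0 := by
    apply AnalyticAt.fun_div
    · fun_prop
    · fun_prop
    · simp
  have hd0 : Filter.Tendsto (fun s : ℝ => s / (1 - s)) (nhds 0) (nhds 0) := by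
    simpa using hd.continuousAt.tendsto
  have hRd : AnalyticAt ℝ (fun s => R (s / (1 - s))) 0 := by
    refine AnalyticAt.fun_comp (g := R) ?_ hd
    simpa using hR
  have h1 : F =ᶠ[nhds 0] fun s =>
      (∑ n ∈ Finset.range (p + 1),
        iteratedDeriv n G 0 / n.factorial * (s ^ n * ((1 - s) ^ (N + n))⁻¹)) +
      s ^ (p + 1) * (((1 - s) ^ (N + (p + 1)))⁻¹ * R (s / (1 - s))) := by
    filter_upwards [hF, hd0.eventually hGR, Iio_mem_nhds (show (0 : ℝ) < 1 by norm_num)]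
      with s h1 h2 hs
    have h0 : 1 - s ≠ 0 := by have := Set.mem_Iio.1 hs; linarith
    rw [h1, h2, mul_add, Finset.mul_sum]
    congr 1
    · refine Finset.sum_congr rfl fun n _ => ?_
      rw [smul_eq_mul, div_pow]
      field_simp
      ring
    · rw [smul_eq_mul, div_pow]
      field_simp
      ring
  have ha : ∀ n, AnalyticAt ℝ (fun s : ℝ =>
      iteratedDeriv n G 0 / n.factorial * (s ^ n * ((1 - s) ^ (N + n))⁻¹)) 0 := fun n =>
    analyticAt_const.mul ((analyticAt_id.pow n).mul (analyticAt_inv_one_sub_pow _))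
  have hb : AnalyticAt ℝ (fun s : ℝ => ((1 - s) ^ (N + (p + 1)))⁻¹ * R (s / (1 - s))) 0 :=
    (analyticAt_inv_one_sub_pow _).mul hRd
  rw [h1.iteratedDeriv_eq, iteratedDeriv_fun_add]
  · rw [iteratedDeriv_pow_mul_eq_zero hb (Nat.lt_succ_self p), add_zero, iteratedDeriv_fun_sum]
    · refine Finset.sum_congr rfl fun n _ => ?_
      rw [iteratedDeriv_const_mul_field, iteratedDeriv_pow_mul_inv_one_sub_pow]
    · exact fun n _ => (ha n).contDiffAt
  · exact (Finset.analyticAt_fun_sum _ fun n _ => ha n).contDiffAt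
  · exact ((analyticAt_id.pow (p + 1)).mul hb).contDiffAt

/-! ### Moments of the zero-forcing gain -/

section Moments

variable {d n N : ℕ}

lemma zero_mem_interior_of_integrable_exp {Ω : Type*} [MeasurableSpace Ω] {P : Measure Ω}
    {X : Ω → ℝ} (h : ∀ s < 1, Integrable (fun ω => Real.exp (s * X ω)) P) :
    0 ∈ interior (integrableExpSet X P) := by
  refine mem_interior.2 ⟨Set.Iio 1, fun s hs => h s hs, isOpen_Iio, by simp⟩

/-- In the central case the mgf is `(1 - s)⁻ᴺ`, that of a Gamma law of shape `N`. -/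
lemma moments_zfGain_stdGaussian {B : Fin n → EuclideanSpace ℂ (Fin d)}
    (hB : LinearIndependent ℂ B) (hN : N + n = d) (p : ℕ) :
    Integrable (fun z => (zfGain z B / 2) ^ p) (stdGaussian (EuclideanSpace ℂ (Fin d))) ∧
      ∫ z, (zfGain z B / 2) ^ p ∂(stdGaussian (EuclideanSpace ℂ (Fin d))) = poch N p := by
  have h0 : 0 ∈ interior (integrableExpSet (fun z => zfGain z B / 2)
      (stdGaussian (EuclideanSpace ℂ (Fin d)))) := by
    refine zero_mem_interior_of_integrable_exp fun s hs => ?_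
    have := integrable_exp_zfGain_stdGaussian hB hN hs 0
    simp only [zero_add] at this
    convert this using 3
    ring
  have h1 : mgf (fun z => zfGain z B / 2) (stdGaussian (EuclideanSpace ℂ (Fin d))) =ᶠ[nhds 0]
      fun s => ((1 - s) ^ N)⁻¹ := by
    filter_upwards [Iio_mem_nhds (show (0 : ℝ) < 1 by norm_num)] with s hs
    have := integral_exp_zfGain_stdGaussian hB hN hs 0
    have hz : zfGain (0 : EuclideanSpace ℂ (Fin d)) B = 0 := by simp [zfGain_eq_norm_sq hB]
    simp only [zero_add, hz, mul_zero, Real.exp_zero, mul_one] at this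
    rw [← this, mgf]
    congr 1
    ext z
    ring_nf
  refine ⟨integrable_pow_of_mem_interior_integrableExpSet h0 p, ?_⟩
  have h2 := iteratedDeriv_mgf_zero h0 p
  rw [h1.iteratedDeriv_eq, iteratedDeriv_inv_one_sub_pow _ _ one_pos] at h2
  simpa using h2.symm

lemma moments_norm_sq_stdGaussian (d p : ℕ) :
    Integrable (fun z => (‖z‖ ^ 2 / 2) ^ p) (stdGaussian (EuclideanSpace ℂ (Fin d))) ∧
      ∫ z, (‖z‖ ^ 2 / 2) ^ p ∂(stdGaussian (EuclideanSpace ℂ (Fin d))) = poch d p := by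
  have := moments_zfGain_stdGaussian (d := d) (n := 0) (N := d) (B := Fin.elim0)
    linearIndependent_empty_type rfl p
  simpa only [zfGain_of_isEmpty] using this

/-- The unitary group is transitive on spheres: the isometry `w ↦ w'` of lines extends to the whole
space. -/
lemma exists_linearIsometryEquiv_apply_eq {w w' : EuclideanSpace ℂ (Fin d)} (h : ‖w‖ = ‖w'‖) :
    ∃ U : EuclideanSpace ℂ (Fin d) ≃ₗᵢ[ℂ] EuclideanSpace ℂ (Fin d), U w = w' := by
  rcases eq_or_ne w 0 with rfl | hw
  · exact ⟨LinearIsometryEquiv.refl _ _, (norm_eq_zero.1 (by simpa using h.symm)).symm⟩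
  have hw' : w' ≠ 0 := fun h' => hw (by simpa [h'] using h)
  let L : (ℂ ∙ w) →ₗᵢ[ℂ] EuclideanSpace ℂ (Fin d) :=
    { toLinearMap := (LinearMap.toSpanSingleton ℂ _ w').comp
        (LinearEquiv.toSpanNonzeroSingleton ℂ _ w hw).symm.toLinearMap
      norm_map' := fun x => by
        obtain ⟨c, rfl⟩ := (LinearEquiv.toSpanNonzeroSingleton ℂ _ w hw).surjective x
        change ‖LinearMap.toSpanSingleton ℂ _ w' ((LinearEquiv.toSpanNonzeroSingleton ℂ _ w hw).symm
          (LinearEquiv.toSpanNonzeroSingleton ℂ _ w hw c))‖ = _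
        rw [LinearEquiv.symm_apply_apply]
        simp [norm_smul, h] }
  refine ⟨LinearIsometryEquiv.ofSurjective L.extend
    (L.extend.toLinearMap.surjective_of_injective L.extend.injective), ?_⟩
  have h1 := L.extend_apply ⟨w, Submodule.mem_span_singleton_self w⟩
  have h2 : (LinearEquiv.toSpanNonzeroSingleton ℂ _ w hw).symm
      ⟨w, Submodule.mem_span_singleton_self w⟩ = 1 := by
    rw [LinearEquiv.symm_apply_eq]
    ext1
    simp
  rw [LinearIsometryEquiv.coe_ofSurjective, h1]
  simp [L, h2]

lemma measurePreserving_stdGaussian (U : EuclideanSpace ℂ (Fin d) ≃ₗᵢ[ℂ] EuclideanSpace ℂ (Fin d)) :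
    MeasurePreserving U (stdGaussian (EuclideanSpace ℂ (Fin d)))
      (stdGaussian (EuclideanSpace ℂ (Fin d))) := by
  refine ⟨U.continuous.measurable, ?_⟩
  refine stdGaussian_map_of_inner_eq
    (U.toContinuousLinearEquiv.toContinuousLinearMap.restrictScalars ℝ) U.symm
    (fun t => U.symm.norm_map t) fun z t => ?_
  rw [real_inner_eq_re_inner_euclidean, real_inner_eq_re_inner_euclidean,
    ← U.inner_map_map z, U.apply_symm_apply]
  rfl

/-- The law of `n` independent standard Gaussian vectors in `ℂᵈ`. -/
noncomputable abbrev gaussianColumns (d n : ℕ) : Measure (Fin n → EuclideanSpace ℂ (Fin d)) :=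
  Measure.pi fun _ => stdGaussian (EuclideanSpace ℂ (Fin d))

/-- A unitary taking `w` to `w'` preserves both the gain and the joint law of the columns. -/
lemma integral_zfGain_pow_eq_of_norm_eq {w w' : EuclideanSpace ℂ (Fin d)} (h : ‖w‖ = ‖w'‖)
    (p : ℕ) :
    ∫ B, zfGain w B ^ p ∂(gaussianColumns d n) = ∫ B, zfGain w' B ^ p ∂(gaussianColumns d n) := by
  obtain ⟨U, rfl⟩ := exists_linearIsometryEquiv_apply_eq h
  have hU : MeasurePreserving (fun (B : Fin n → EuclideanSpace ℂ (Fin d)) j => U (B j))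
      (gaussianColumns d n) (gaussianColumns d n) :=
    measurePreserving_pi _ _ fun _ => measurePreserving_stdGaussian U
  have h1 := integral_map (f := fun B => zfGain (U w) B ^ p) hU.aemeasurable
    ((measurable_zfGain.comp measurable_prodMk_left).pow_const p).aestronglyMeasurable
  rw [hU.map_eq] at h1
  rw [h1]
  simp only [zfGain_map]

lemma integral_zfGain_pow_eq_mul (hn : n ≤ d) {e : EuclideanSpace ℂ (Fin d)} (he : ‖e‖ = 1)
    (w : EuclideanSpace ℂ (Fin d)) (p : ℕ) :
    ∫ B, zfGain w B ^ p ∂(gaussianColumns d n) =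
      (‖w‖ ^ 2) ^ p * ∫ B, zfGain e B ^ p ∂(gaussianColumns d n) := by
  have h1 : ‖w‖ = ‖((‖w‖ : ℝ) : ℂ) • e‖ := by simp [norm_smul, he]
  rw [integral_zfGain_pow_eq_of_norm_eq h1, ← integral_const_mul]
  refine integral_congr_ae ?_
  filter_upwards [ae_linearIndependent_stdGaussian hn] with B hB
  rw [zfGain_smul hB, mul_pow]
  simp

/-- The moments of the zero-forcing gain of a deterministic column. -/
lemma integral_zfGain_pow (hd : 0 < d) (hN : N + n = d) (w : EuclideanSpace ℂ (Fin d)) (p : ℕ) :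
    ∫ B, zfGain w B ^ p ∂(gaussianColumns d n) = (‖w‖ ^ 2) ^ p * (poch N p / poch d p) := by
  have hn : n ≤ d := by omega
  let e : EuclideanSpace ℂ (Fin d) := EuclideanSpace.single ⟨0, hd⟩ 1
  have he : ‖e‖ = 1 := by simp [e]
  rw [integral_zfGain_pow_eq_mul hn he]
  congr 1
  set c := ∫ B, zfGain e B ^ p ∂(gaussianColumns d n)
  have hpd : poch d p ≠ 0 := (poch_pos (by exact_mod_cast hd) p).ne'
  rw [eq_div_iff hpd]
  have hint : Integrable (fun q : EuclideanSpace ℂ (Fin d) × (Fin n → EuclideanSpace ℂ (Fin d)) =>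
      (zfGain q.1 q.2 / 2) ^ p)
      ((stdGaussian (EuclideanSpace ℂ (Fin d))).prod (gaussianColumns d n)) := by
    -- Almost surely the gain is at most `‖z‖²`, whose moments are finite.
    refine ((moments_norm_sq_stdGaussian d p).1.comp_fst (gaussianColumns d n)).mono'
      ((measurable_zfGain.div_const 2).pow_const p).aestronglyMeasurable ?_
    have h1 : ∀ᵐ q ∂((stdGaussian (EuclideanSpace ℂ (Fin d))).prod (gaussianColumns d n)),
        LinearIndependent ℂ q.2 :=
      Measure.quasiMeasurePreserving_snd.ae (ae_linearIndependent_stdGaussian hn)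
    filter_upwards [h1] with q hq
    have := zfGain_nonneg hq q.1
    have := zfGain_le hq q.1
    rw [Real.norm_of_nonneg (by positivity)]
    gcongr
  -- Integrating over `B` first gives `c (d)_p`; integrating over `z` first gives `(N)_p`.
  -- Comparison determines `c`.
  have hswap := integral_integral_swap (f := fun z B => (zfGain z B / 2) ^ p) hint
  have hL : ∀ z : EuclideanSpace ℂ (Fin d),
      ∫ B, (zfGain z B / 2) ^ p ∂(gaussianColumns d n) = (‖z‖ ^ 2 / 2) ^ p * c := by
    intro z
    simp only [div_pow]
    rw [integral_div, integral_zfGain_pow_eq_mul hn he]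
    ring
  have hR : ∫ B, ∫ z, (zfGain z B / 2) ^ p ∂(stdGaussian (EuclideanSpace ℂ (Fin d)))
      ∂(gaussianColumns d n) = poch N p := by
    rw [integral_congr_ae (g := fun _ => poch N p)]
    · simp
    · filter_upwards [ae_linearIndependent_stdGaussian hn] with B hB
      exact (moments_zfGain_stdGaussian hB hN p).2
  rw [hR] at hswap
  simp only [hL] at hswap
  rw [integral_mul_const, (moments_norm_sq_stdGaussian d p).2] at hswap
  rw [← hswap, mul_comm]

lemma integrable_exp_zfGain_gaussianColumns (hn : n ≤ d) (w : EuclideanSpace ℂ (Fin d)) (t : ℝ) :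
    Integrable (fun B => Real.exp (t * (zfGain w B / 2))) (gaussianColumns d n) := by
  refine Integrable.of_bound (C := Real.exp (|t| * (‖w‖ ^ 2 / 2))) ?_ ?_
  · exact (((measurable_zfGain.comp measurable_prodMk_left).div_const 2).const_mul
      t).exp.aestronglyMeasurable
  · filter_upwards [ae_linearIndependent_stdGaussian hn] with B hB
    rw [Real.norm_of_nonneg (Real.exp_pos _).le, Real.exp_le_exp]
    have := zfGain_nonneg hB w
    have := zfGain_le hB w
    gcongr
    exact le_abs_self t

variable {s : ℝ}

lemma measurable_exp_zfGain_add (w : EuclideanSpace ℂ (Fin d)) (s : ℝ) :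
    Measurable fun q : EuclideanSpace ℂ (Fin d) × (Fin n → EuclideanSpace ℂ (Fin d)) =>
      Real.exp (s * (zfGain (w + q.1) q.2 / 2)) :=
  (((measurable_zfGain.comp ((measurable_fst.const_add w).prodMk measurable_snd)).div_const
    2).const_mul s).exp

/-- Given `B`, the integral over `z` is explicit, and it is integrable in `B` because `zfGain w B`
is almost surely bounded by `‖w‖²`. -/
lemma integrable_exp_zfGain_add (hN : N + n = d) (w : EuclideanSpace ℂ (Fin d)) (hs : s < 1) :
    Integrable (fun q : EuclideanSpace ℂ (Fin d) × (Fin n → EuclideanSpace ℂ (Fin d)) =>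
      Real.exp (s * (zfGain (w + q.1) q.2 / 2)))
      ((stdGaussian (EuclideanSpace ℂ (Fin d))).prod (gaussianColumns d n)) := by
  have hn : n ≤ d := by omega
  have hc : ∀ (z : EuclideanSpace ℂ (Fin d)) (B : Fin n → EuclideanSpace ℂ (Fin d)),
      Real.exp (s * (zfGain (w + z) B / 2)) = Real.exp (s / 2 * zfGain (w + z) B) :=
    fun _ _ => by congr 1; ring
  refine (integrable_prod_iff' (measurable_exp_zfGain_add w s).aestronglyMeasurable).2 ⟨?_, ?_⟩
  · filter_upwards [ae_linearIndependent_stdGaussian hn] with B hB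
    simp only [hc]
    exact integrable_exp_zfGain_stdGaussian hB hN hs w
  · refine ((integrable_exp_zfGain_gaussianColumns hn w (s / (1 - s))).const_mul
      ((1 - s) ^ N)⁻¹).congr ?_
    filter_upwards [ae_linearIndependent_stdGaussian hn] with B hB
    simp only [Real.norm_of_nonneg (Real.exp_pos _).le, hc]
    rw [integral_exp_zfGain_stdGaussian hB hN hs w]
    have : 1 - s ≠ 0 := by linarith
    congr 2
    field_simp

lemma integral_exp_zfGain_add (hN : N + n = d) (w : EuclideanSpace ℂ (Fin d)) (hs : s < 1) :
    ∫ q, Real.exp (s * (zfGain (w + q.1) q.2 / 2))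
      ∂((stdGaussian (EuclideanSpace ℂ (Fin d))).prod (gaussianColumns d n)) =
      ((1 - s) ^ N)⁻¹ * mgf (fun B => zfGain w B / 2) (gaussianColumns d n) (s / (1 - s)) := by
  have hn : n ≤ d := by omega
  rw [integral_prod_symm _ (integrable_exp_zfGain_add hN w hs), mgf, ← integral_const_mul]
  refine integral_congr_ae ?_
  filter_upwards [ae_linearIndependent_stdGaussian hn] with B hB
  have hc : ∀ z, Real.exp (s * (zfGain (w + z) B / 2)) =
      Real.exp (s / 2 * zfGain (w + z) B) := fun _ => by ring_nf
  simp only [hc]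
  rw [integral_exp_zfGain_stdGaussian hB hN hs w]
  have : 1 - s ≠ 0 := by linarith
  congr 2
  field_simp

/-- The moments of a noncentral zero-forcing gain. -/
lemma iteratedDeriv_mgf_zfGain_add (hd : 0 < d) (hN : N + n = d)
    (w : EuclideanSpace ℂ (Fin d)) (p : ℕ) :
    iteratedDeriv p (mgf (fun q : EuclideanSpace ℂ (Fin d) × (Fin n → EuclideanSpace ℂ (Fin d)) =>
      zfGain (w + q.1) q.2 / 2)
      ((stdGaussian (EuclideanSpace ℂ (Fin d))).prod (gaussianColumns d n))) 0 =
      ∑ k ∈ Finset.range (p + 1), seriesCoeff N d k (‖w‖ ^ 2 / 2) *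
        ∑ m ∈ Finset.range (k + 1),
          (k.choose m : ℝ) * (-1) ^ m * poch ((N + k - m : ℕ) : ℝ) p := by
  have hn : n ≤ d := by omega
  have h0 : 0 ∈ interior (integrableExpSet (fun B => zfGain w B / 2) (gaussianColumns d n)) :=
    zero_mem_interior_of_integrable_exp fun s _ => integrable_exp_zfGain_gaussianColumns hn w s
  rw [iteratedDeriv_comp_div_one_sub (analyticAt_mgf h0) (N := N)]
  · refine Finset.sum_congr rfl fun k _ => ?_
    congr 1
    -- The `k`-th derivative of `G` at 0 is a moment of the gain of the fixed column `w`.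
    rw [iteratedDeriv_mgf_zero h0, seriesCoeff]
    simp only [Pi.pow_apply, div_pow]
    rw [integral_div, integral_zfGain_pow hd hN]
    ring
  · filter_upwards [Iio_mem_nhds (show (0 : ℝ) < 1 by norm_num)] with s hs
    exact integral_exp_zfGain_add hN w hs

end Moments

/-! ### The law of the whitened channel -/

section Law

variable {Ω : Type*} [MeasurableSpace Ω] {P : Measure Ω} {d m : ℕ}

/-- Reduces covariances of real parts to the Hermitian covariance and the pseudo-covariance. -/
lemma re_mul_re_eq (u v : ℂ) : u.re * v.re = (star u * v + u * v).re / 2 := by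
  simp [Complex.mul_re]

lemma hasGaussianLaw_row {C : Matrix (Fin m) (Fin m) ℂ} {Hr : Ω → Fin d → Fin m → ℂ}
    (hlaw : ∀ i, HasComplexGaussianLaw (fun ω j => star (Hr ω i j)) 0 C P) (i : Fin d) :
    HasGaussianLaw (fun ω => Hr ω i) P := by
  have h := (hlaw i).gaussian.map_fun
    (ContinuousLinearMap.pi fun j : Fin m => Complex.conjCLE.toContinuousLinearMap ∘L
      ContinuousLinearMap.proj (R := ℝ) (φ := fun _ : Fin m => ℂ) j)
  have he : (fun ω => Hr ω i) = fun ω => (ContinuousLinearMap.pi fun j : Fin m =>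
      Complex.conjCLE.toContinuousLinearMap ∘L
        ContinuousLinearMap.proj (R := ℝ) (φ := fun _ : Fin m => ℂ) j)
      fun j => star (Hr ω i j) := by
    funext ω j
    simp
  rw [he]
  exact h

/-- The channel matrix multiplied by `A`, by columns. -/
noncomputable def columnsMulL (d : ℕ) (A : Matrix (Fin m) (Fin m) ℂ) :
    (Fin d → Fin m → ℂ) →L[ℝ] (Fin m → EuclideanSpace ℂ (Fin d)) :=
  LinearMap.toContinuousLinearMap
    { toFun := fun H j => WithLp.toLp 2 fun i => ∑ k, H i k * A k j
      map_add' := fun x y => by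
        ext j i
        simp [add_mul, Finset.sum_add_distrib]
      map_smul' := fun c x => by
        ext j i
        simp [mul_assoc, Finset.mul_sum] }

lemma columnsMulL_apply (A : Matrix (Fin m) (Fin m) ℂ) (H : Fin d → Fin m → ℂ) (j : Fin m)
    (i : Fin d) : columnsMulL d A H j i = ∑ k, H i k * A k j := rfl

variable {C A : Matrix (Fin m) (Fin m) ℂ} {Hr : Ω → Fin d → Fin m → ℂ}

section Entries

variable (hlaw : ∀ i, HasComplexGaussianLaw (fun ω j => star (Hr ω i j)) 0 C P)
  (hind : iIndepFun (fun (i : Fin d) (ω : Ω) => Hr ω i) P)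

include hlaw in
lemma memLp_entry (i : Fin d) (k : Fin m) : MemLp (fun ω => Hr ω i k) 2 P :=
  ((hasGaussianLaw_row hlaw i).eval k).memLp_two

include hlaw in
lemma integral_entry (i : Fin d) (k : Fin m) : ∫ ω, Hr ω i k ∂P = 0 := by
  have h := (hlaw i).mean k
  have h2 := integral_conj (μ := P) (f := fun ω => Hr ω i k)
  simp only [Pi.zero_apply] at h
  rw [← star_star (∫ ω, Hr ω i k ∂P)]
  have h3 : star (∫ ω, Hr ω i k ∂P) = 0 := h2.symm.trans h
  rw [h3, star_zero]

include hlaw hind in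
lemma integral_entry_mul_entry (i i' : Fin d) (k k' : Fin m) :
    ∫ ω, Hr ω i k * Hr ω i' k' ∂P = 0 := by
  rcases eq_or_ne i i' with rfl | hi
  · have h := (hlaw i).pseudoCovariance k k'
    have h2 := integral_conj (μ := P) (f := fun ω => Hr ω i k * Hr ω i k')
    simp only [Pi.zero_apply, sub_zero] at h
    simp only [map_mul] at h2
    have h3 : star (∫ ω, Hr ω i k * Hr ω i k' ∂P) = 0 := h2.symm.trans h
    rw [← star_star (∫ ω, Hr ω i k * Hr ω i k' ∂P), h3, star_zero]
  · have h := (hind.indepFun hi).comp (measurable_pi_apply k) (measurable_pi_apply k')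
    have h2 := h.integral_fun_mul_eq_mul_integral (memLp_entry hlaw i k).1
      (memLp_entry hlaw i' k').1
    simp only [Function.comp_apply] at h2
    rw [h2, integral_entry hlaw, zero_mul]

include hlaw hind in
lemma integral_star_entry_mul_entry (i i' : Fin d) (k k' : Fin m) :
    ∫ ω, star (Hr ω i k) * Hr ω i' k' ∂P = if i = i' then C k k' else 0 := by
  split_ifs with hi
  · subst hi
    simpa using (hlaw i).covariance k k'
  · have h := (hind.indepFun hi).comp (measurable_pi_apply k) (measurable_pi_apply k')
    have h' := h.comp (φ := fun z : ℂ => star z) (ψ := id) continuous_star.measurable measurable_id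
    have h2 := h'.integral_fun_mul_eq_mul_integral (memLp_entry hlaw i k).star.1
      (memLp_entry hlaw i' k').1
    simp only [Function.comp_apply, id] at h2
    rw [h2, integral_entry hlaw, mul_zero]

end Entries

/-- The complex linear functional `∑ i, conj (x i) (H A) i j` of the channel matrix. -/
noncomputable def columnForm (A : Matrix (Fin m) (Fin m) ℂ) (x : EuclideanSpace ℂ (Fin d))
    (j : Fin m) (H : Fin d → Fin m → ℂ) : ℂ :=
  ∑ i, ∑ k, (star (x i) * A k j) * H i k

lemma real_inner_columnsMulL (x : EuclideanSpace ℂ (Fin d)) (j : Fin m)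
    (H : Fin d → Fin m → ℂ) :
    inner ℝ x (columnsMulL d A H j) = (columnForm A x j H).re := by
  rw [real_inner_eq_re_inner_euclidean, PiLp.inner_apply, columnForm]
  congr 1
  refine Finset.sum_congr rfl fun i _ => ?_
  rw [columnsMulL_apply, RCLike.inner_apply, Finset.sum_mul]
  refine Finset.sum_congr rfl fun k _ => ?_
  simp only [starRingEnd_apply]
  ring

section Law

variable (hlaw : ∀ i, HasComplexGaussianLaw (fun ω j => star (Hr ω i j)) 0 C P)
  (hind : iIndepFun (fun (i : Fin d) (ω : Ω) => Hr ω i) P)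

include hlaw in
lemma memLp_columnForm (x : EuclideanSpace ℂ (Fin d)) (j : Fin m) :
    MemLp (fun ω => columnForm A x j (Hr ω)) 2 P :=
  memLp_finsetSum _ fun i _ => memLp_finsetSum _ fun k _ => (memLp_entry hlaw i k).const_mul _

include hlaw in
lemma integral_columnForm (x : EuclideanSpace ℂ (Fin d)) (j : Fin m) [IsProbabilityMeasure P] :
    ∫ ω, columnForm A x j (Hr ω) ∂P = 0 := by
  have hi : ∀ i k, Integrable (fun ω => (star (x i) * A k j) * Hr ω i k) P := fun i k =>
    ((memLp_entry hlaw i k).integrable one_le_two).const_mul _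
  unfold columnForm
  rw [integral_finsetSum _ fun i _ => integrable_finsetSum _ fun k _ => hi i k]
  refine Finset.sum_eq_zero fun i _ => ?_
  rw [integral_finsetSum _ fun k _ => hi i k]
  refine Finset.sum_eq_zero fun k _ => ?_
  rw [integral_const_mul, integral_entry hlaw, mul_zero]

include hlaw hind in
lemma integral_columnForm_mul_columnForm (x y : EuclideanSpace ℂ (Fin d)) (j l : Fin m) :
    ∫ ω, columnForm A x j (Hr ω) * columnForm A y l (Hr ω) ∂P = 0 := by
  have hi : ∀ i k i' k', Integrable (fun ω => ((star (x i) * A k j) * (star (y i') * A k' l)) *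
      (Hr ω i k * Hr ω i' k')) P := fun i k i' k' =>
    ((memLp_entry hlaw i k).integrable_mul (memLp_entry hlaw i' k')).const_mul _
  have he : ∀ ω, columnForm A x j (Hr ω) * columnForm A y l (Hr ω) =
      ∑ i, ∑ i', ∑ k, ∑ k', ((star (x i) * A k j) * (star (y i') * A k' l)) *
      (Hr ω i k * Hr ω i' k') := by
    intro ω
    simp only [columnForm, Finset.sum_mul_sum]
    refine Finset.sum_congr rfl fun i _ => Finset.sum_congr rfl fun i' _ =>
      Finset.sum_congr rfl fun k _ => Finset.sum_congr rfl fun k' _ => by ring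
  simp only [he]
  rw [integral_finsetSum _ fun i _ => integrable_finsetSum _ fun i' _ =>
    integrable_finsetSum _ fun k _ => integrable_finsetSum _ fun k' _ => hi i k i' k']
  refine Finset.sum_eq_zero fun i _ => ?_
  rw [integral_finsetSum _ fun i' _ =>
    integrable_finsetSum _ fun k _ => integrable_finsetSum _ fun k' _ => hi i k i' k']
  refine Finset.sum_eq_zero fun i' _ => ?_
  rw [integral_finsetSum _ fun k _ => integrable_finsetSum _ fun k' _ => hi i k i' k']
  refine Finset.sum_eq_zero fun k _ => ?_
  rw [integral_finsetSum _ fun k' _ => hi i k i' k']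
  refine Finset.sum_eq_zero fun k' _ => ?_
  rw [integral_const_mul, integral_entry_mul_entry hlaw hind, mul_zero]

include hlaw hind in
-- Cross terms between distinct rows vanish; each row contributes the same entry of `Aᴴ C A`.
lemma integral_star_columnForm_mul_columnForm (x y : EuclideanSpace ℂ (Fin d)) (j l : Fin m) :
    ∫ ω, star (columnForm A x j (Hr ω)) * columnForm A y l (Hr ω) ∂P =
      (A.conjTranspose * C * A) j l * inner ℂ y x := by
  have hi : ∀ i k i' k', Integrable (fun ω =>
      ((x i * star (A k j)) * (star (y i') * A k' l)) *
      (star (Hr ω i k) * Hr ω i' k')) P := fun i k i' k' =>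
    ((memLp_entry hlaw i k).star.integrable_mul (memLp_entry hlaw i' k')).const_mul _
  have he : ∀ ω, star (columnForm A x j (Hr ω)) * columnForm A y l (Hr ω) =
      ∑ i, ∑ i', ∑ k, ∑ k', ((x i * star (A k j)) * (star (y i') * A k' l)) *
      (star (Hr ω i k) * Hr ω i' k') := by
    intro ω
    simp only [columnForm, star_sum, star_mul', star_star, Finset.sum_mul_sum]
    refine Finset.sum_congr rfl fun i _ => Finset.sum_congr rfl fun i' _ =>
      Finset.sum_congr rfl fun k _ => Finset.sum_congr rfl fun k' _ => by ring
  simp only [he]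
  have h1 : ∀ i i', ∫ ω, ∑ k, ∑ k', ((x i * star (A k j)) * (star (y i') * A k' l)) *
      (star (Hr ω i k) * Hr ω i' k') ∂P =
      if i = i' then (A.conjTranspose * C * A) j l * (x i * star (y i)) else 0 := by
    intro i i'
    rw [integral_finsetSum _ fun k _ => integrable_finsetSum _ fun k' _ => hi i k i' k']
    simp only [integral_finsetSum _ fun k' _ => hi i _ i' k', integral_const_mul,
      integral_star_entry_mul_entry hlaw hind]
    split_ifs with h
    · subst h
      simp only [Matrix.mul_apply, Finset.sum_mul, Matrix.conjTranspose_apply]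
      rw [Finset.sum_comm]
      refine Finset.sum_congr rfl fun k _ => Finset.sum_congr rfl fun k' _ => by ring
    · simp
  rw [integral_finsetSum _ fun i _ => integrable_finsetSum _ fun i' _ =>
    integrable_finsetSum _ fun k _ => integrable_finsetSum _ fun k' _ => hi i k i' k',
    PiLp.inner_apply, Finset.mul_sum]
  refine Finset.sum_congr rfl fun i _ => ?_
  rw [integral_finsetSum _ fun i' _ =>
    integrable_finsetSum _ fun k _ => integrable_finsetSum _ fun k' _ => hi i k i' k']
  simp only [h1]
  simp

include hlaw hind in
-- The pseudo-covariance vanishes, and the 2 in `hA` cancels the 1/2 from taking real parts: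
-- `stdGaussian` has unit variance in each real direction.
lemma covariance_inner_columnsMulL [IsProbabilityMeasure P]
    (hA : A.conjTranspose * C * A = (2 : ℂ) • 1) (x y : EuclideanSpace ℂ (Fin d))
    (j l : Fin m) :
    cov[fun ω => inner ℝ x (columnsMulL d A (Hr ω) j),
      fun ω => inner ℝ y (columnsMulL d A (Hr ω) l); P] = if j = l then inner ℝ y x else 0 := by
  have hx := memLp_columnForm (A := A) hlaw x j
  have hy := memLp_columnForm (A := A) hlaw y l
  simp only [real_inner_columnsMulL]
  have hx' : MemLp (fun ω => (columnForm A x j (Hr ω)).re) 2 P := hx.re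
  have hy' : MemLp (fun ω => (columnForm A y l (Hr ω)).re) 2 P := hy.re
  rw [covariance_eq_sub hx' hy']
  have h0 : ∫ ω, (columnForm A x j (Hr ω)).re ∂P = 0 := by
    have := integral_re (hx.integrable one_le_two)
    rw [integral_columnForm hlaw] at this
    simpa using this
  have h1 := integral_columnForm_mul_columnForm (A := A) hlaw hind x y j l
  have h2 := integral_star_columnForm_mul_columnForm (A := A) hlaw hind x y j l
  have i1 : Integrable (fun ω => columnForm A x j (Hr ω) * columnForm A y l (Hr ω)) P :=
    hx.integrable_mul hy
  have i2 : Integrable (fun ω => star (columnForm A x j (Hr ω)) * columnForm A y l (Hr ω)) P :=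
    hx.star.integrable_mul hy
  have h3 : ∫ ω, (columnForm A x j (Hr ω)).re * (columnForm A y l (Hr ω)).re ∂P =
      ((A.conjTranspose * C * A) j l * inner ℂ y x).re / 2 := by
    simp only [re_mul_re_eq]
    rw [integral_div]
    have h4 := integral_re (i2.add i1)
    simp only [Pi.add_apply, RCLike.re_to_complex] at h4
    rw [h4, integral_add i2 i1, h1, h2, add_zero]
  change ∫ ω, (columnForm A x j (Hr ω)).re * (columnForm A y l (Hr ω)).re ∂P -
    (∫ ω, (columnForm A x j (Hr ω)).re ∂P) * _ = _
  rw [h0, zero_mul, sub_zero, h3, hA, Matrix.smul_apply, Matrix.one_apply,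
    real_inner_eq_re_inner_euclidean]
  split_ifs <;> simp

include hlaw hind in
/-- The whitened columns are independent standard Gaussian vectors. -/
lemma map_columnsMulL [IsProbabilityMeasure P]
    (hA : A.conjTranspose * C * A = (2 : ℂ) • 1) :
    P.map (fun ω => columnsMulL d A (Hr ω)) = gaussianColumns d m := by
  have hG : HasGaussianLaw (fun ω j => columnsMulL d A (Hr ω) j) P :=
    (hind.hasGaussianLaw fun i => hasGaussianLaw_row hlaw i).map_fun (columnsMulL d A)
  -- Jointly Gaussian and uncorrelated columns are independent.
  have hI : iIndepFun (fun j ω => columnsMulL d A (Hr ω) j) P := by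
    refine hG.iIndepFun_of_covariance_inner fun j l hjl x y => ?_
    rw [covariance_inner_columnsMulL hlaw hind hA, if_neg hjl]
  have hm : ∀ j, AEMeasurable (fun ω => columnsMulL d A (Hr ω) j) P := fun j =>
    (hG.eval j).aemeasurable
  rw [(iIndepFun_iff_map_fun_eq_pi_map hm).1 hI]
  congr 1
  ext1 j
  have : IsProbabilityMeasure (P.map fun ω => columnsMulL d A (Hr ω) j) :=
    Measure.isProbabilityMeasure_map (hm j)
  apply Measure.ext_of_charFun
  ext t
  rw [(hG.eval j).charFun_map_eq, charFun_stdGaussian, ← covariance_self,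
    covariance_inner_columnsMulL hlaw hind hA, if_pos rfl, real_inner_self_eq_norm_sq]
  · have : ∫ ω, inner ℝ t (columnsMulL d A (Hr ω) j) ∂P = 0 := by
      simp only [real_inner_columnsMulL]
      have := integral_re ((memLp_columnForm (A := A) hlaw t j).integrable one_le_two)
      rw [integral_columnForm hlaw] at this
      simpa using this
    simp [this, neg_div]
  · exact (hm j).const_inner

end Law

end Law

/-! ### Whitening -/

section Whitening

open Matrix

variable {n : ℕ}

open scoped MatrixOrder Matrix.Norms.L2Operator in
lemma exists_eq_conjTranspose_mul_self_of_posSemidef {R : Matrix (Fin (n + 1)) (Fin (n + 1)) ℂ}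
    (hR : R.PosSemidef) : ∃ B : Matrix (Fin (n + 1)) (Fin (n + 1)) ℂ, R = Bᴴ * B :=
  CStarAlgebra.nonneg_iff_eq_star_mul_self.1 hR.nonneg

/-- A factorization `R = A Aᴴ` of a positive definite matrix in which the first row of `A` is
supported on the first column. -/
lemma exists_mul_conjTranspose_eq_of_posDef {R : Matrix (Fin (n + 1)) (Fin (n + 1)) ℂ}
    (hR : R.PosDef) :
    ∃ A : Matrix (Fin (n + 1)) (Fin (n + 1)) ℂ, A * Aᴴ = R ∧ ∀ j, j ≠ 0 → A 0 j = 0 := by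
  obtain ⟨B, hB⟩ := exists_eq_conjTranspose_mul_self_of_posSemidef hR.posSemidef
  let r : EuclideanSpace ℂ (Fin (n + 1)) := WithLp.toLp 2 fun k => B k 0
  have hr : r ≠ 0 := by
    intro h
    have h1 : R 0 0 = 0 := by
      rw [hB, Matrix.mul_apply]
      refine Finset.sum_eq_zero fun k _ => ?_
      have : B k 0 = 0 := congrArg (fun v : EuclideanSpace ℂ (Fin (n + 1)) => v k) h
      rw [this, mul_zero]
    exact hR.diag_pos.ne' h1
  -- Only `v 0` matters. The unitary `V` gets the direction of `r` as first column, so the first row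
  -- of `Bᴴ V`, with entries `⟪r, b j⟫`, vanishes for `j ≠ 0`.
  let v : Fin (n + 1) → EuclideanSpace ℂ (Fin (n + 1)) := fun _ => ((‖r‖ : ℂ)⁻¹) • r
  have hv : Orthonormal ℂ (({0} : Set (Fin (n + 1))).domRestrict v) := by
    refine ⟨fun i => ?_, fun i j hij => absurd (Subsingleton.elim i j) hij⟩
    simp [v, norm_smul, hr]
  obtain ⟨b, hb⟩ := hv.exists_orthonormalBasis_extension_of_card_eq (by simp)
  have hb0 : r = (‖r‖ : ℂ) • b 0 := by
    rw [hb 0 rfl, smul_smul, mul_inv_cancel₀ (by simpa using hr), one_smul]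
  let V : Matrix (Fin (n + 1)) (Fin (n + 1)) ℂ := Matrix.of fun k j => b j k
  have hV : Vᴴ * V = 1 := by
    ext i j
    rw [Matrix.mul_apply, Matrix.one_apply, ← orthonormal_iff_ite.1 b.orthonormal i j,
      PiLp.inner_apply]
    refine Finset.sum_congr rfl fun k _ => ?_
    simp [V, mul_comm]
  have hV' : V * Vᴴ = 1 := mul_eq_one_comm.1 hV
  refine ⟨Bᴴ * V, ?_, fun j hj => ?_⟩
  · rw [conjTranspose_mul, conjTranspose_conjTranspose, Matrix.mul_assoc, ← Matrix.mul_assoc V,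
      hV', Matrix.one_mul, hB]
  · have h1 : (Bᴴ * V) 0 j = inner ℂ r (b j) := by
      rw [Matrix.mul_apply, PiLp.inner_apply]
      refine Finset.sum_congr rfl fun k _ => ?_
      simp [V, r, mul_comm]
    rw [h1, hb0, inner_smul_left, b.orthonormal.2 hj.symm, mul_zero]

/-- A whitening matrix whose first row is supported on the first column. -/
lemma exists_whitening {C : Matrix (Fin (n + 1)) (Fin (n + 1)) ℂ} (hC : C.PosDef) :
    ∃ A : Matrix (Fin (n + 1)) (Fin (n + 1)) ℂ, Aᴴ * C * A = (2 : ℂ) • 1 ∧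
      (∀ j, j ≠ 0 → A 0 j = 0) ∧ ‖A 0 0‖ ^ 2 = 2 * (C⁻¹ 0 0).re ∧ A 0 0 ≠ 0 ∧ IsUnit A.det := by
  -- Factoring `2 C⁻¹ = A Aᴴ` yields both the whitening identity and, from the corner entry, `‖A 0
  -- 0‖²`.
  have h2 : ((2 : ℝ) • C⁻¹).PosDef := hC.inv.smul (by norm_num)
  obtain ⟨A, hA, h0⟩ := exists_mul_conjTranspose_eq_of_posDef h2
  have hCu : IsUnit C.det := (Matrix.isUnit_iff_isUnit_det _).1 hC.isUnit
  have h3 : A * (Aᴴ * ((2 : ℂ)⁻¹ • C)) = 1 := by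
    rw [← Matrix.mul_assoc, hA]
    ext i j
    have := congrFun (congrFun (Matrix.nonsing_inv_mul C hCu) i) j
    rw [← this]
    simp [Matrix.mul_apply]
    refine Finset.sum_congr rfl fun k _ => by ring
  have h4 := mul_eq_one_comm.1 h3
  have hdet : IsUnit A.det := (Matrix.isUnit_iff_isUnit_det _).1 ⟨⟨A, _, h3, h4⟩, rfl⟩
  have h00 : ((‖A 0 0‖ ^ 2 : ℝ) : ℂ) = 2 * C⁻¹ 0 0 := by
    have := congrFun (congrFun hA 0) 0
    rw [Matrix.mul_apply, Finset.sum_eq_single 0] at this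
    · simp only [conjTranspose_apply, Matrix.smul_apply] at this
      rw [Complex.ofReal_pow, ← Complex.mul_conj']
      simpa using this
    · intro j _ hj
      rw [h0 j hj, zero_mul]
    · simp
  refine ⟨A, ?_, h0, ?_, ?_, hdet⟩
  · have : Aᴴ * C * A = (2 : ℂ) • (Aᴴ * ((2 : ℂ)⁻¹ • C) * A) := by
      simp [smul_smul]
    rw [this, h4]
  · have := congrArg Complex.re h00
    rw [Complex.ofReal_re] at this
    simpa using this
  · intro h
    have h1 : C⁻¹ 0 0 = 0 := by simpa [h] using h00.symm
    exact hC.inv.diag_pos.ne' h1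

/-- The first row of `A⁻¹` is again supported on the first column, so the corner of `A⁻¹ W⁻¹ A⁻ᴴ`
sees only the corner of `W⁻¹`. -/
lemma inv_conj_apply_zero_zero {A W : Matrix (Fin (n + 1)) (Fin (n + 1)) ℂ} (hA : IsUnit A.det)
    (h0 : ∀ j, j ≠ 0 → A 0 j = 0) (h00 : A 0 0 ≠ 0) :
    ((Aᴴ * W * A)⁻¹ 0 0).re = (‖A 0 0‖ ^ 2)⁻¹ * (W⁻¹ 0 0).re := by
  have hrow : ∀ j, A⁻¹ 0 j = if j = 0 then (A 0 0)⁻¹ else 0 := by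
    intro j
    have h1 : (A * A⁻¹) 0 j = (1 : Matrix (Fin (n + 1)) (Fin (n + 1)) ℂ) 0 j := by
      rw [Matrix.mul_nonsing_inv _ hA]
    rw [Matrix.mul_apply, Finset.sum_eq_single 0 (fun k _ hk => by rw [h0 k hk, zero_mul])
      (by simp), Matrix.one_apply] at h1
    rw [← mul_right_inj' h00, h1]
    split_ifs with h2 h3 h3
    · rw [mul_inv_cancel₀ h00]
    · exact absurd h2.symm h3
    · exact absurd h3.symm h2
    · simp
  have h1 : (Aᴴ * W * A)⁻¹ 0 0 = (A 0 0)⁻¹ * W⁻¹ 0 0 * star (A 0 0)⁻¹ := by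
    rw [Matrix.mul_inv_rev, Matrix.mul_inv_rev, ← Matrix.mul_assoc, Matrix.mul_apply,
      Finset.sum_eq_single 0]
    · rw [← conjTranspose_nonsing_inv, conjTranspose_apply, hrow 0, Matrix.mul_apply,
        Finset.sum_eq_single 0]
      · simp [hrow]
      · intro k _ hk
        rw [hrow, if_neg hk, zero_mul]
      · simp
    · intro k _ hk
      rw [← conjTranspose_nonsing_inv, conjTranspose_apply, hrow, if_neg hk, star_zero, mul_zero]
    · simp
  have h2 : (A 0 0)⁻¹ * W⁻¹ 0 0 * star (A 0 0)⁻¹ = (((‖A 0 0‖ ^ 2)⁻¹ : ℝ) : ℂ) * W⁻¹ 0 0 := by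
    have : (A 0 0)⁻¹ * star (A 0 0)⁻¹ = (((‖A 0 0‖ ^ 2)⁻¹ : ℝ) : ℂ) := by
      rw [Complex.star_def, Complex.mul_conj']
      simp
    rw [← this]
    ring
  rw [h1, h2, Complex.re_ofReal_mul]

/-- The zero-forcing SNR in terms of the gain of the whitened columns. -/
lemma zfSNR_eq_zfGain {d : ℕ} {C A : Matrix (Fin (n + 1)) (Fin (n + 1)) ℂ} (hA : IsUnit A.det)
    (h0 : ∀ j, j ≠ 0 → A 0 j = 0) (h00 : A 0 0 ≠ 0) (hC : ‖A 0 0‖ ^ 2 = 2 * (C⁻¹ 0 0).re)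
    (Γ : ℝ) (M Hr : Matrix (Fin d) (Fin (n + 1)) ℂ) (hM : ∀ i, ∀ k, k ≠ 0 → M i k = 0) :
    zfSNR Γ (M + Hr) = Γ / (C⁻¹ 0 0).re *
      (zfGain ((WithLp.toLp 2 fun i => M i 0 * A 0 0) + columnsMulL d A Hr 0)
        (fun j => columnsMulL d A Hr j.succ) / 2) := by
  have hg : Matrix.gram ℂ (Fin.cons ((WithLp.toLp 2 fun i => M i 0 * A 0 0) +
      columnsMulL d A Hr 0) (fun j => columnsMulL d A Hr j.succ) :
        Fin (n + 1) → EuclideanSpace ℂ (Fin d)) = Aᴴ * ((M + Hr)ᴴ * (M + Hr)) * A := by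
    have hc : ∀ j i, (Fin.cons ((WithLp.toLp 2 fun i => M i 0 * A 0 0) +
      columnsMulL d A Hr 0) (fun j => columnsMulL d A Hr j.succ) :
        Fin (n + 1) → EuclideanSpace ℂ (Fin d)) j i = ((M + Hr) * A) i j := by
      intro j i
      -- Whitening keeps the mean in the first column, thanks to the shape of the first row of `A`.
      have hMA : (M * A) i j = if j = 0 then M i 0 * A 0 0 else 0 := by
        rw [Matrix.mul_apply, Finset.sum_eq_single 0]
        · split_ifs with h
          · rw [h]
          · rw [h0 j h, mul_zero]
        · intro k _ hk
          rw [hM i k hk, zero_mul]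
        · simp
      rw [Matrix.add_mul, Matrix.add_apply, hMA]
      refine Fin.cases ?_ (fun k => ?_) j
      · simp [Matrix.mul_apply]
        rfl
      · simp [Matrix.mul_apply]
        rfl
    have hW : Aᴴ * ((M + Hr)ᴴ * (M + Hr)) * A = ((M + Hr) * A)ᴴ * ((M + Hr) * A) := by
      rw [conjTranspose_mul]
      simp only [Matrix.mul_assoc]
    rw [hW]
    ext j l
    rw [Matrix.gram_apply, PiLp.inner_apply, Matrix.mul_apply]
    refine Finset.sum_congr rfl fun i _ => ?_
    rw [hc, hc, RCLike.inner_apply, conjTranspose_apply, mul_comm, starRingEnd_apply]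
  have hpos : 0 < ‖A 0 0‖ ^ 2 := by positivity
  rw [hC] at hpos
  have hne : (C⁻¹ 0 0).re ≠ 0 := by
    intro h
    simp [h] at hpos
  rw [zfGain, hg, inv_conj_apply_zero_zero hA h0 h00, hC, zfSNR]
  field_simp

end Whitening

/-! ### Moments of the zero-forcing SNR -/

/-- The polynomial in the noncentrality parameter `a` that gives the `p`-th moment. -/
noncomputable def momentSum (N d p : ℕ) (a : ℝ) : ℝ :=
  ∑ k ∈ Finset.range (p + 1), seriesCoeff N d k a *
    ∑ m ∈ Finset.range (k + 1), (k.choose m : ℝ) * (-1) ^ m * poch ((N + k - m : ℕ) : ℝ) p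

lemma hasSum_momentSum (N d p : ℕ) (a : ℝ) :
    HasSum (fun k : ℕ => seriesCoeff N d k a * ∑ m ∈ Finset.range (k + 1),
      (k.choose m : ℝ) * (-1) ^ m * poch ((N + k - m : ℕ) : ℝ) p) (momentSum N d p a) := by
  refine hasSum_sum_of_ne_finset_zero fun k hk => ?_
  rw [sum_choose_poch_eq_zero N (by simpa [Nat.lt_succ_iff] using hk), mul_zero]

lemma momentSum_one {N d : ℕ} (hN : 0 < N) (hd : 0 < d) (a : ℝ) :
    momentSum N d 1 a = N * (1 + a / d) := by
  have h1 : (N : ℝ) ≠ 0 := by positivity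
  have h2 : (d : ℝ) ≠ 0 := by positivity
  simp [momentSum, seriesCoeff, Finset.sum_range_succ, poch_one, poch_zero]
  field_simp

lemma momentSum_two {N d : ℕ} (hd : 0 < d) (a : ℝ) :
    momentSum N d 2 a =
      N * (N + 1) * ((1 + a / d) ^ 2 - a ^ 2 / (d : ℝ) ^ 2 * (1 / (d + 1))) := by
  have h2 : (d : ℝ) ≠ 0 := by positivity
  have h3 : (d : ℝ) + 1 ≠ 0 := by positivity
  simp [momentSum, seriesCoeff, Finset.sum_range_succ, poch_one, poch_zero, poch_two,
    Nat.factorial]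
  field_simp
  ring

section Core

variable {Ω : Type*} [MeasurableSpace Ω] {P : Measure Ω} [IsProbabilityMeasure P] {d n N : ℕ}

omit [IsProbabilityMeasure P] in
lemma map_fst_tail_gaussianColumns {Y : Ω → Fin (n + 1) → EuclideanSpace ℂ (Fin d)}
    (hY : P.map Y = gaussianColumns d (n + 1)) :
    AEMeasurable (fun ω => (Y ω 0, fun j : Fin n => Y ω j.succ)) P ∧
    P.map (fun ω => (Y ω 0, fun j : Fin n => Y ω j.succ)) =
      (stdGaussian (EuclideanSpace ℂ (Fin d))).prod (gaussianColumns d n) := by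
  have hm : AEMeasurable Y P := by
    -- The pushforward along a map that is not a.e. measurable is 0 by convention.
    apply AEMeasurable.of_map_ne_zero
    rw [hY]
    exact IsProbabilityMeasure.ne_zero _
  have hmp := measurePreserving_piFinSuccAbove
    (fun _ : Fin (n + 1) => stdGaussian (EuclideanSpace ℂ (Fin d))) 0
  have he : (fun ω => (Y ω 0, fun j : Fin n => Y ω j.succ)) =
      (MeasurableEquiv.piFinSuccAbove (fun _ : Fin (n + 1) => EuclideanSpace ℂ (Fin d)) 0) ∘ Y := by
    funext ω
    simp [MeasurableEquiv.piFinSuccAbove, Fin.insertNthEquiv]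
    rfl
  rw [he]
  refine ⟨hmp.measurable.comp_aemeasurable hm, ?_⟩
  rw [← AEMeasurable.map_map_of_aemeasurable hmp.measurable.aemeasurable hm, hY, hmp.map_eq]

variable {C : Matrix (Fin (n + 1)) (Fin (n + 1)) ℂ} {Hr : Ω → Matrix (Fin d) (Fin (n + 1)) ℂ}

/-- The moments of the zero-forcing SNR of a channel whose mean vanishes outside the first column
and whose rows are independent circularly symmetric complex Gaussian vectors. -/
theorem moments_zfSNR (hd : 0 < d) (hN : N + n = d) (hC : C.PosDef)
    (hlaw : ∀ i, HasComplexGaussianLaw (fun ω j => star (Hr ω i j)) 0 C P)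
    (hind : iIndepFun (fun (i : Fin d) (ω : Ω) => Hr ω i) P)
    (Γ : ℝ) {M : Matrix (Fin d) (Fin (n + 1)) ℂ} (hM : ∀ i, ∀ k, k ≠ 0 → M i k = 0) :
    0 ∈ interior (integrableExpSet (fun ω => zfSNR Γ (M + Hr ω)) P) ∧
    ∀ p : ℕ, ∫ ω, zfSNR Γ (M + Hr ω) ^ p ∂P =
      (Γ / (C⁻¹ 0 0).re) ^ p * momentSum N d p ((C⁻¹ 0 0).re * ∑ i, ‖M i 0‖ ^ 2) := by
  obtain ⟨A, hA, h0, hAC, h00, hdet⟩ := exists_whitening hC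
  set g : ℝ := Γ / (C⁻¹ 0 0).re
  set w : EuclideanSpace ℂ (Fin d) := WithLp.toLp 2 fun i => M i 0 * A 0 0
  have hw : ‖w‖ ^ 2 / 2 = (C⁻¹ 0 0).re * ∑ i, ‖M i 0‖ ^ 2 := by
    rw [EuclideanSpace.norm_sq_eq]
    simp only [w, norm_mul, mul_pow, ← Finset.sum_mul, hAC]
    ring
  obtain ⟨hZm, hZ⟩ := map_fst_tail_gaussianColumns (n := n)
    (map_columnsMulL (Hr := Hr) hlaw hind hA)
  set Z : Ω → EuclideanSpace ℂ (Fin d) × (Fin n → EuclideanSpace ℂ (Fin d)) :=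
    fun ω => (columnsMulL d A (Hr ω) 0, fun j : Fin n => columnsMulL d A (Hr ω) j.succ)
  set X : EuclideanSpace ℂ (Fin d) × (Fin n → EuclideanSpace ℂ (Fin d)) → ℝ :=
    fun q => zfGain (w + q.1) q.2 / 2
  have hγ : ∀ ω, zfSNR Γ (M + Hr ω) = g * X (Z ω) := fun ω =>
    zfSNR_eq_zfGain hdet h0 h00 hAC Γ M (Hr ω) hM
  have hXm : Measurable X :=
    (measurable_zfGain.comp ((measurable_fst.const_add w).prodMk measurable_snd)).div_const 2
  have hX0 : 0 ∈ interior (integrableExpSet X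
      ((stdGaussian (EuclideanSpace ℂ (Fin d))).prod (gaussianColumns d n))) :=
    zero_mem_interior_of_integrable_exp fun s hs => integrable_exp_zfGain_add hN w hs
  constructor
  -- This open set contains 0 whatever the sign of `g`.
  · refine mem_interior.2 ⟨{s | s * g < 1}, fun s hs => ?_,
      isOpen_lt (by fun_prop) continuous_const, by simp⟩
    have h1 := integrable_exp_zfGain_add hN w (Set.mem_ofPred.1 hs)
    rw [← hZ, integrable_map_measure
      (measurable_exp_zfGain_add w (s * g)).aestronglyMeasurable hZm] at h1
    change Integrable (fun ω => Real.exp (s * zfSNR Γ (M + Hr ω))) P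
    simp only [hγ, ← mul_assoc]
    exact h1
  · intro p
    simp only [hγ, mul_pow]
    rw [integral_const_mul, ← integral_map (f := fun q => X q ^ p) hZm
      (hXm.pow_const p).aestronglyMeasurable, hZ]
    congr 1
    rw [← hw]
    exact (iteratedDeriv_mgf_zero hX0 p).symm.trans (iteratedDeriv_mgf_zfGain_add hd hN w p)

end Core

/-! ### The fading model -/

section Model

variable {Ω : Type*} [MeasurableSpace Ω] {P : Measure Ω} {nR nT : ℕ} {K : ℝ}
  {Hdn : Matrix (Fin nR) (Fin nT) ℂ} {RT : Matrix (Fin nT) (Fin nT) ℂ}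
  {Hrn : Ω → Matrix (Fin nR) (Fin nT) ℂ}

lemma HasComplexGaussianLaw.real_smul {ι : Type*} [Fintype ι] {X : Ω → ι → ℂ}
    {C : Matrix ι ι ℂ} (hX : HasComplexGaussianLaw X 0 C P) (c : ℝ) :
    HasComplexGaussianLaw (fun ω i => (c : ℂ) * X ω i) 0 (((c ^ 2 : ℝ) : ℂ) • C) P where
  gaussian := by
    convert! hX.gaussian.fun_smul c using 1
  mean i := by
    have := hX.mean i
    rw [integral_const_mul, this]
    simp
  covariance i j := by
    have := hX.covariance i j
    simp only [Pi.zero_apply, sub_zero, Matrix.smul_apply, smul_eq_mul, star_mul',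
      Complex.star_def, Complex.conj_ofReal] at this ⊢
    rw [← this, ← integral_const_mul]
    congr 1
    ext ω
    push_cast
    ring
  pseudoCovariance i j := by
    have := hX.pseudoCovariance i j
    simp only [Pi.zero_apply, sub_zero] at this ⊢
    rw [show (0 : ℂ) = (c : ℂ) ^ 2 * 0 by simp, ← this, ← integral_const_mul]
    congr 1
    ext ω
    ring

lemma IsFadingModel.channelRandom_law (h : IsFadingModel K Hdn RT Hrn P) (i : Fin nR) :
    HasComplexGaussianLaw (fun ω j => star (channelRandom K Hrn ω i j)) 0 (transmitCov K RT) P := by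
  have hK := h.K_nonneg
  have := (h.rows_law i).real_smul √(1 / (K + 1))
  rw [Real.sq_sqrt (by positivity)] at this
  convert this using 1
  · funext ω j
    simp [channelRandom]
  · rfl

lemma IsFadingModel.channelRandom_indep (h : IsFadingModel K Hdn RT Hrn P) :
    iIndepFun (fun (i : Fin nR) (ω : Ω) => channelRandom K Hrn ω i) P :=
  h.rows_indep.comp (fun _ r => ((√(1 / (K + 1)) : ℝ) : ℂ) • r)
    fun _ => measurable_id.const_smul ((√(1 / (K + 1)) : ℝ) : ℂ)

lemma IsFadingModel.transmitCov_posDef (h : IsFadingModel K Hdn RT Hrn P) :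
    (transmitCov K RT).PosDef := by
  have hK := h.K_nonneg
  refine h.correlation_posDef.smul ?_
  rw [Complex.zero_lt_real]
  positivity

lemma transmitCov_inv (hK : 0 ≤ K) (hR : RT.PosDef) :
    (transmitCov K RT)⁻¹ = ((K + 1 : ℝ) : ℂ) • RT⁻¹ := by
  apply Matrix.inv_eq_right_inv
  have h0 : K + 1 ≠ 0 := by positivity
  have hu : IsUnit RT.det := (Matrix.isUnit_iff_isUnit_det _).1 hR.isUnit
  rw [transmitCov, Matrix.smul_mul, Matrix.mul_smul, smul_smul, ← Complex.ofReal_mul,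
    Matrix.mul_nonsing_inv _ hu, one_div, inv_mul_cancel₀ h0]
  simp

lemma Matrix.PosDef.inv_diag_re_pos (hR : RT.PosDef) (k : Fin nT) : 0 < (RT⁻¹ k k).re :=
  (Complex.lt_def.1 hR.inv.diag_pos).1

variable [NeZero nT]

lemma IsRicianRayleigh.residualMean_eq (h : IsRicianRayleigh K Hdn) (i : Fin nR) :
    residualMean K Hdn RT i = channelMean K Hdn i 0 := by
  rw [residualMean, Finset.sum_eq_zero, sub_zero]
  intro k _
  rw [h i k k.2, zero_mul]

lemma IsRicianRayleigh.sum_norm_sq_channelMean (h : IsRicianRayleigh K Hdn)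
    (hm : IsFadingModel K Hdn RT Hrn P) :
    ∑ i, ‖channelMean K Hdn i 0‖ ^ 2 = K / (K + 1) * (nT * nR) := by
  have hK := hm.K_nonneg
  rw [← hm.mean_normalized, Finset.mul_sum]
  refine Finset.sum_congr rfl fun i _ => ?_
  -- The scaled mean is what vanishes off the first column, so `K = 0`, where `Hdn` is unconstrained
  -- there, is covered too.
  have h1 : ∀ k, ‖channelMean K Hdn i k‖ ^ 2 = K / (K + 1) * ‖Hdn i k‖ ^ 2 := by
    intro k
    rw [channelMean, Matrix.smul_apply, norm_smul, mul_pow, Complex.norm_real, Real.norm_eq_abs,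
      sq_abs, Real.sq_sqrt (by positivity)]
  rw [Finset.mul_sum, Finset.sum_eq_single 0]
  · exact h1 0
  · intro k _ hk
    rw [← h1, h i k hk]
    simp
  · simp

lemma IsRicianRayleigh.ricianParam_eq (h : IsRicianRayleigh K Hdn)
    (hm : IsFadingModel K Hdn RT Hrn P) :
    ricianParam K Hdn RT = K * nR * nT * (RT⁻¹ 0 0).re := by
  have hK := hm.K_nonneg
  have h0 : K + 1 ≠ 0 := by positivity
  simp only [ricianParam, h.residualMean_eq]
  rw [h.sum_norm_sq_channelMean hm, transmitCov_inv hK hm.correlation_posDef, Matrix.smul_apply,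
    smul_eq_mul, Complex.re_ofReal_mul]
  field_simp

lemma inputSNR_pos {Es N0 : ℝ} (hEs : 0 < Es) (hN0 : 0 < N0) : 0 < inputSNR nT Es N0 := by
  have : 0 < nT := Nat.pos_of_ne_zero (NeZero.ne nT)
  unfold inputSNR
  positivity

/-- The mean `M` is left free so that both the Rician channel and the channel with its mean removed
are instances. -/
lemma IsFadingModel.moments_zfSNR [IsProbabilityMeasure P] (hm : IsFadingModel K Hdn RT Hrn P)
    (hT : nT ≤ nR) {N : ℕ} (hN : N = nR - nT + 1) (Γ : ℝ) {M : Matrix (Fin nR) (Fin nT) ℂ}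
    (hM : ∀ i, ∀ k, k ≠ 0 → M i k = 0) :
    0 ∈ interior (integrableExpSet (fun ω => zfSNR Γ (M + channelRandom K Hrn ω)) P) ∧
    ∀ p : ℕ, ∫ ω, zfSNR Γ (M + channelRandom K Hrn ω) ^ p ∂P =
      gammaScale Γ K RT ^ p *
        momentSum N nR p (((transmitCov K RT)⁻¹ 0 0).re * ∑ i, ‖M i 0‖ ^ 2) := by
  obtain ⟨n, rfl⟩ : ∃ n, nT = n + 1 := Nat.exists_eq_succ_of_ne_zero (NeZero.ne nT)
  exact _root_.moments_zfSNR (by omega) (by omega) hm.transmitCov_posDef hm.channelRandom_law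
    hm.channelRandom_indep Γ hM

/-- The average zero-forcing SNR under Rayleigh fading. -/
lemma IsFadingModel.integral_zfSNR_channelRandom [IsProbabilityMeasure P]
    (hm : IsFadingModel K Hdn RT Hrn P) (hT : nT ≤ nR) {N : ℕ} (hN : N = nR - nT + 1) (Γ : ℝ) :
    ∫ ω, zfSNR Γ (channelRandom K Hrn ω) ∂P = N * gammaScale Γ K RT := by
  have hnT : 0 < nT := Nat.pos_of_ne_zero (NeZero.ne nT)
  have := (hm.moments_zfSNR hT hN Γ (M := 0) (by simp)).2 1
  rw [momentSum_one (by omega) (by omega)] at this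
  simp only [zero_add, pow_one] at this
  rw [this]
  simp [mul_comm]

end Model

/-! ### Moments, amount of fading and array gain of stream 1. -/

theorem mainTheorem5 {Ω : Type*} [MeasurableSpace Ω] (P : Measure Ω) [IsProbabilityMeasure P]
    {nR nT : ℕ} [NeZero nT] (hT : nT ≤ nR)
    (Es N0 : ℝ) (hEs : 0 < Es) (hN0 : 0 < N0) (K : ℝ)
    (Hdn : Matrix (Fin nR) (Fin nT) ℂ) (RT : Matrix (Fin nT) (Fin nT) ℂ)
    (Hrn : Ω → Matrix (Fin nR) (Fin nT) ℂ)
    (hmodel : IsFadingModel K Hdn RT Hrn P) (hRR : IsRicianRayleigh K Hdn)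
    (N : ℕ) (hN : N = nR - nT + 1)
    (Γs : ℝ) (hΓs : Γs = inputSNR nT Es N0)
    (Γ₁ : ℝ) (hΓ₁ : Γ₁ = gammaScale Γs K RT)
    (a : ℝ) (ha : a = ricianParam K Hdn RT)
    (γ₁ : Ω → ℝ) (hγ₁ : γ₁ = fun ω => zfSNR Γs (channelMatrix K Hdn Hrn ω)) :
    -- moments, variance and amount of fading, Rician–Rayleigh fading
    (∫ ω, γ₁ ω ∂P = N * Γ₁ * (1 + a / nR) ∧
      ∫ ω, γ₁ ω ^ 2 ∂P =
        N * (N + 1) * Γ₁ ^ 2 * ((1 + a / nR) ^ 2 - a ^ 2 / (nR : ℝ) ^ 2 * (1 / (nR + 1))) ∧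
      variance γ₁ P =
        N * Γ₁ ^ 2 * ((1 + a / nR) ^ 2 - a ^ 2 / (nR : ℝ) ^ 2 * ((N + 1) / (nR + 1))) ∧
      amountOfFading γ₁ P =
        1 / N * (1 - (N + 1) / (nR + 1) * (a ^ 2 / (a + nR) ^ 2))) ∧
    -- the same for Rayleigh–Rayleigh fading
    (K = 0 →
      ∫ ω, γ₁ ω ∂P = N * Γ₁ ∧
      ∫ ω, γ₁ ω ^ 2 ∂P = N * (N + 1) * Γ₁ ^ 2 ∧
      variance γ₁ P = N * Γ₁ ^ 2 ∧
      amountOfFading γ₁ P = 1 / N) ∧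
    -- moments of every order
    AnalyticAt ℝ (mgf γ₁ P) 0 ∧
    (∀ p : ℕ, Integrable (fun ω => γ₁ ω ^ p) P ∧
      ∫ ω, γ₁ ω ^ p ∂P = iteratedDeriv p (mgf γ₁ P) 0 ∧
      ∃ S : ℝ, HasSum (fun n : ℕ => seriesCoeff N nR n a *
          ∑ m ∈ Finset.range (n + 1),
            (n.choose m : ℝ) * (-1) ^ m * poch ((N + n - m : ℕ) : ℝ) p) S ∧
        ∫ ω, γ₁ ω ^ p ∂P = Γ₁ ^ p * S) ∧
    -- array gain over Rayleigh fading with the same `Γ₁`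
    a = K * nR * nT * ((RT⁻¹) 0 0).re ∧
    1 + a / nR = 1 + K * nT * ((RT⁻¹) 0 0).re ∧
    arrayGain γ₁ P (fun ω => zfSNR Γs (channelRandom K Hrn ω)) P = 1 + a / nR ∧
    (∀ {Ω' : Type*} [MeasurableSpace Ω'] (Q : Measure Ω') [IsProbabilityMeasure Q]
      (Es' N0' : ℝ), 0 < Es' → 0 < N0' →
      ∀ (Hdn' : Matrix (Fin nR) (Fin nT) ℂ) (RT' : Matrix (Fin nT) (Fin nT) ℂ)
        (Hrn' : Ω' → Matrix (Fin nR) (Fin nT) ℂ),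
      IsFadingModel 0 Hdn' RT' Hrn' Q →
      gammaScale (inputSNR nT Es' N0') 0 RT' = Γ₁ →
      arrayGain γ₁ P
        (fun ω => zfSNR (inputSNR nT Es' N0') (channelMatrix 0 Hdn' Hrn' ω)) Q
        = 1 + a / nR) := by
  subst hN
  set N := nR - nT + 1 with hN
  have hnT : 0 < nT := Nat.pos_of_ne_zero (NeZero.ne nT)
  have hnR : 0 < nR := by omega
  have hK := hmodel.K_nonneg
  have haK := hRR.ricianParam_eq hmodel
  rw [← ha] at haK
  have hR := hmodel.correlation_posDef.inv_diag_re_pos 0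
  have ha0 : 0 ≤ a := by rw [haK]; positivity
  have hΓs_pos : 0 < Γs := hΓs ▸ inputSNR_pos hEs hN0
  have hC := hmodel.transmitCov_posDef.inv_diag_re_pos 0
  have hΓ₁_pos : 0 < Γ₁ := by rw [hΓ₁]; exact div_pos hΓs_pos hC
  have hNpos : (0 : ℝ) < N := by simp only [hN]; positivity
  have hnR' : (0 : ℝ) < nR := by exact_mod_cast hnR
  have hgain : 1 + a / nR ≠ 0 := by positivity
  obtain ⟨h0, hmom⟩ := hmodel.moments_zfSNR hT hN Γs (M := channelMean K Hdn) hRR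
  have haM : ((transmitCov K RT)⁻¹ 0 0).re * ∑ i, ‖channelMean K Hdn i 0‖ ^ 2 = a := by
    rw [ha]
    simp only [ricianParam, hRR.residualMean_eq]
  rw [haM, ← hΓ₁] at hmom
  change 0 ∈ interior (integrableExpSet (fun ω => zfSNR Γs (channelMatrix K Hdn Hrn ω)) P) at h0
  change ∀ p : ℕ, ∫ ω, zfSNR Γs (channelMatrix K Hdn Hrn ω) ^ p ∂P = _ at hmom
  rw [← hγ₁] at h0
  have hmom' : ∀ p : ℕ, ∫ ω, γ₁ ω ^ p ∂P = Γ₁ ^ p * momentSum N nR p a := by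
    intro p
    rw [hγ₁]
    exact hmom p
  have hint : ∀ p : ℕ, Integrable (fun ω => γ₁ ω ^ p) P := fun p =>
    integrable_pow_of_mem_interior_integrableExpSet h0 p
  have hE1 : ∫ ω, γ₁ ω ∂P = N * Γ₁ * (1 + a / nR) := by
    have := hmom' 1
    simp only [pow_one] at this
    rw [this, momentSum_one (by omega) hnR]
    ring
  have hE2 : ∫ ω, γ₁ ω ^ 2 ∂P =
      N * (N + 1) * Γ₁ ^ 2 * ((1 + a / nR) ^ 2 - a ^ 2 / (nR : ℝ) ^ 2 * (1 / (nR + 1))) := by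
    rw [hmom' 2, momentSum_two hnR]
    ring
  have hV : variance γ₁ P =
      N * Γ₁ ^ 2 * ((1 + a / nR) ^ 2 - a ^ 2 / (nR : ℝ) ^ 2 * ((N + 1) / (nR + 1))) := by
    have hm : AEStronglyMeasurable γ₁ P := by simpa using (hint 1).1
    have hE2' : ∫ ω, (γ₁ ^ 2) ω ∂P = _ := hE2
    rw [variance_eq_sub ((memLp_two_iff_integrable_sq hm).2 (hint 2)), hE2', hE1]
    ring
  have hAF : amountOfFading γ₁ P =
      1 / N * (1 - (N + 1) / (nR + 1) * (a ^ 2 / (a + nR) ^ 2)) := by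
    rw [amountOfFading, hV, hE1]
    have h1 : (nR : ℝ) + 1 ≠ 0 := by positivity
    have h2 : a + nR ≠ 0 := by positivity
    have h3 : 1 + a / nR = (a + nR) / nR := by field_simp; ring
    rw [h3]
    field_simp
  refine ⟨⟨hE1, hE2, hV, hAF⟩, fun hK0 => ?_, analyticAt_mgf h0, fun p => ⟨hint p, ?_, ?_⟩,
    haK, ?_, ?_, ?_⟩
  · have ha00 : a = 0 := by rw [haK, hK0]; ring
    rw [hE1, hE2, hV, hAF, ha00]
    simp
  · exact (iteratedDeriv_mgf_zero h0 p).symm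
  · exact ⟨momentSum N nR p a, hasSum_momentSum N nR p a, hmom' p⟩
  · rw [haK]
    field_simp
  · rw [arrayGain, hE1, hmodel.integral_zfSNR_channelRandom hT hN, ← hΓ₁]
    field_simp
  · intro Ω' _ Q _ Es' N0' _ _ Hdn' RT' Hrn' hmodel' hΓ'
    -- At `K = 0` the factor `√(K / (K + 1))` kills the mean, so the reference average is `N * Γ₁`.
    have hz : ∀ ω, channelMatrix 0 Hdn' Hrn' ω = channelRandom 0 Hrn' ω := fun ω => by
      simp [channelMatrix, channelMean]
    simp only [hz]
    rw [arrayGain, hE1, hmodel'.integral_zfSNR_channelRandom hT hN, hΓ']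
    field_simp
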